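/- **Conventions.** A Boolean relation of arity $n$ is a nonempty set $R\subseteq\{0,1\}^n$. For $i\in\{0,1\}$, $R$ is $i$-valid if $(i,\dots,i)\in R$, and $i$-default if, for every $\vec r\in R$ and every coordinate $j$, the vector obtained from $\vec r$ by changing its $j$-th entry to $i$ is again in $R$. $[x]$ is the unary relation $\{1\}$ and $[\neg x]$ is the unary relation $\{0\}$. For a class $S$ of Boolean relations, an $S$-formula over a set $V$ of variables is an expression $R(y_1,\dots,y_n)$ with $R\in S$ of arity $n$ and $y_1,\dots,y_n\in V$ (repetitions allowed); each formula, and each other finite object, has exactly one code number, as in Simpson's coding in $\mathsf{RCA}_0$. A set $C$ of $S$-formulas is finitely satisfiable if every finite subset of $C$ is satisfied by some assignment of truth values to the variables. $\mathsf{SAT}(S)$ is the statement: for every infinite set $V$ of variables and every finitely satisfiable set $C$ of $S$-formulas over $V$ there is an assignment $\nu:V\to\{0,1\}$ satisfying all formulas in $C$. $\mathsf{WKL}$ is weak König's lemma (every infinite subtree of $2^{<\mathbb N}$ has a path). $\mathsf{RCA}_0$ is the theory in the language of second-order arithmetic given by the basic axioms for $0,1,+,\cdot,<$, the $\Sigma^0_1$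 induction scheme and the $\Delta^0_1$ comprehension scheme; provable over $\mathsf{RCA}_0$ means true in every model of $\mathsf{RCA}_0$ (equivalently, by the completeness theorem, derivable). **Theorem 1.7.** Let $S$ be a possibly infinite class of nonempty Boolean relations, with no effectiveness requirement, and consider the conditions - (a) every relation in $S$ is $0$-valid; - (b) every relation in $S$ is $1$-valid; - (c) every relation in $S$ that is not $0$-default equals $[x]$; - (d) every relation in $S$ that is not $1$-default equals $[\neg x]$. If $S$ satisfies at least one of (a)–(d), then $\mathsf{SAT}(S)$ is provable over $\mathsf{RCA}_0$. Otherwise $\mathsf{SAT}(S)$ is equivalent to $\mathsf{WKL}$ over $\mathsf{RCA}_0$. This holds in both of the following senses. 1. $S$ is a set of Boolean relations in the metatheory, (a)–(d) are read in the metatheory, and in a model of $\mathsf{RCA}_0$ the statement $\mathsf{SAT}(S)$ refers to the codes in that model of the elements of $S$. 2. Uniformly inside $\mathsf{RCA}_0$: in every model $\mathcal M$ of $\mathsf{RCA}_0$ and for every class $S$ of (codes of) nonempty Boolean relations in the sense of $\mathcal M$ (of possibly nonstandard arity, $S$ not necessarily belonging to the second-order part of $\mathcal M$), if one of (a)–(d)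 holds in $\mathcal M$ then $\mathcal M\models\mathsf{SAT}(S)$, and otherwise $\mathcal M\models\mathsf{SAT}(S)\leftrightarrow\mathsf{WKL}$. -/

import Mathlib

/-! Second-order arithmetic (two-sorted, general models), the theory `RCA₀`, the coding of finite
objects by numbers, the principles `WKL` and `SAT(S)`. -/

universe u

/-- A structure for the language of second-order arithmetic: a number sort with
`0, 1, +, ·, <`, and a set sort that is a nonempty family of subsets of the number sort,
with true membership as `∈`. No arithmetic law is assumed here. -/
structure L2Structure where
  Num : Type u
  zero : Num
  one : Num
  add : Num → Num → Num
  mul : Num → Num → Num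
  lt : Num → Num → Prop
  sets : Set (Set Num)
  sets_nonempty : sets.Nonempty

namespace L2Structure

instance (𝔐 : L2Structure.{u}) : Zero 𝔐.Num := ⟨𝔐.zero⟩
instance (𝔐 : L2Structure.{u}) : One 𝔐.Num := ⟨𝔐.one⟩
instance (𝔐 : L2Structure.{u}) : Add 𝔐.Num := ⟨𝔐.add⟩
instance (𝔐 : L2Structure.{u}) : Mul 𝔐.Num := ⟨𝔐.mul⟩
instance (𝔐 : L2Structure.{u}) : LT 𝔐.Num := ⟨𝔐.lt⟩

end L2Structure

/-- Numerical terms; `var i` is the `i`-th number variable. -/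
inductive NumTerm where
  | var : ℕ → NumTerm
  | zero : NumTerm
  | one : NumTerm
  | add : NumTerm → NumTerm → NumTerm
  | mul : NumTerm → NumTerm → NumTerm

/-- Formulas with bounded number quantifiers only and no set quantifiers (`Σ⁰₀` formulas).
`mem t j` is `t ∈ X_j` for the `j`-th set variable, and `ball i t θ` is
`∀ x_i < t, θ`, where the bound `t` is evaluated outside the quantifier. -/
inductive BddFormula where
  | eq : NumTerm → NumTerm → BddFormula
  | lt : NumTerm → NumTerm → BddFormula
  | mem : NumTerm → ℕ → BddFormula
  | neg : BddFormula → BddFormula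
  | and : BddFormula → BddFormula → BddFormula
  | ball : ℕ → NumTerm → BddFormula → BddFormula

namespace L2Structure

variable (𝔐 : L2Structure.{u})

/-- Value of a term under an assignment `e` of the number variables. -/
def value (e : ℕ → 𝔐.Num) : NumTerm → 𝔐.Num
  | .var i => e i
  | .zero => 0
  | .one => 1
  | .add s t => value e s + value e t
  | .mul s t => value e s * value e t

/-- Truth of a bounded formula under assignments `e` of the number variables and `E` of the
set variables. -/
def Holds (E : ℕ → Set 𝔐.Num) : BddFormula → (ℕ → 𝔐.Num) → Prop
  | .eq s t, e => 𝔐.value e s = 𝔐.value e t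
  | .lt s t, e => 𝔐.value e s < 𝔐.value e t
  | .mem t j, e => 𝔐.value e t ∈ E j
  | .neg θ, e => ¬ Holds E θ e
  | .and θ η, e => Holds E θ e ∧ Holds E η e
  | .ball i t θ, e => ∀ a, a < 𝔐.value e t → Holds E θ (Function.update e i a)

/-- Truth of the `Σ⁰₁` formula `∃ x₁ θ` at `x₀ = a`; the other variables are parameters. -/
def SigmaHolds (E : ℕ → Set 𝔐.Num) (θ : BddFormula) (e : ℕ → 𝔐.Num) (a : 𝔐.Num) : Prop :=
  ∃ b, 𝔐.Holds E θ (Function.update (Function.update e 0 a) 1 b)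

/-- Truth of the `Π⁰₁` formula `∀ x₁ θ` at `x₀ = a`; the other variables are parameters. -/
def PiHolds (E : ℕ → Set 𝔐.Num) (θ : BddFormula) (e : ℕ → 𝔐.Num) (a : 𝔐.Num) : Prop :=
  ∀ b, 𝔐.Holds E θ (Function.update (Function.update e 0 a) 1 b)

/-- `𝔐` is a model of `RCA₀`: the basic axioms, `Σ⁰₁` induction and `Δ⁰₁` comprehension,
both schemes with arbitrary number and set parameters from `𝔐`. -/
structure ModelsRCA0 : Prop where
  add_one_ne_zero : ∀ n : 𝔐.Num, n + 1 ≠ 0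
  add_one_inj : ∀ m n : 𝔐.Num, m + 1 = n + 1 → m = n
  add_zero : ∀ m : 𝔐.Num, m + 0 = m
  add_succ : ∀ m n : 𝔐.Num, m + (n + 1) = (m + n) + 1
  mul_zero : ∀ m : 𝔐.Num, m * 0 = 0
  mul_succ : ∀ m n : 𝔐.Num, m * (n + 1) = m * n + m
  not_lt_zero : ∀ m : 𝔐.Num, ¬ m < 0
  lt_succ : ∀ m n : 𝔐.Num, m < n + 1 ↔ (m < n ∨ m = n)
  sigma_induction : ∀ (θ : BddFormula) (e : ℕ → 𝔐.Num) (E : ℕ → Set 𝔐.Num),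
    (∀ j, E j ∈ 𝔐.sets) →
    𝔐.SigmaHolds E θ e 0 →
    (∀ n, 𝔐.SigmaHolds E θ e n → 𝔐.SigmaHolds E θ e (n + 1)) →
    ∀ n, 𝔐.SigmaHolds E θ e n
  delta_comprehension : ∀ (θ η : BddFormula) (e : ℕ → 𝔐.Num) (E : ℕ → Set 𝔐.Num),
    (∀ j, E j ∈ 𝔐.sets) →
    (∀ n, 𝔐.SigmaHolds E θ e n ↔ 𝔐.PiHolds E η e n) →
    ∃ X ∈ 𝔐.sets, ∀ n, n ∈ X ↔ 𝔐.SigmaHolds E θ e n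

variable {𝔐}

/-! ### Finite objects coded by numbers. All notions below are evaluated inside `𝔐`. -/

/-- The pairing function `(i, j) = (i + j)² + i`. -/
def pair (i j : 𝔐.Num) : 𝔐.Num := (i + j) * (i + j) + i

/-- `i` belongs to the finite set given by the number `c = (k, (m, n))`, namely
`{i < k : m(i + 1) + 1 divides n}`. -/
def FMem (i c : 𝔐.Num) : Prop :=
  ∃ k m n, c = pair k (pair m n) ∧ i < k ∧ ∃ q, n = (m * (i + 1) + 1) * q

/-- `c` is *the* code of a finite set: the least number giving that set. Every finite set thus has
exactly one code, and finite objects are equal iff their codes are. -/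
def IsFinset (c : 𝔐.Num) : Prop :=
  ∀ c', c' < c → ∃ i, ¬ (FMem i c' ↔ FMem i c)

/-- The `i`-th entry of the sequence coded by `s` is `x`. -/
def Entry (s i x : 𝔐.Num) : Prop := FMem (pair i x) s

/-- `s` is the code of a finite sequence of length `l`, i.e. of a function with domain
`{i : i < l}`, as a finite set of pairs. -/
def IsSeq (s l : 𝔐.Num) : Prop :=
  IsFinset s ∧ (∀ p, FMem p s → ∃ i x, i < l ∧ p = pair i x) ∧ ∀ i, i < l → ∃! x, Entry s i x

/-- `s` is the code of an element of `{0,1}^l`. -/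
def IsString (s l : 𝔐.Num) : Prop :=
  IsSeq s l ∧ ∀ i x, Entry s i x → x = 0 ∨ x = 1

/-- `X` is infinite (unbounded). -/
def Infinite (X : Set 𝔐.Num) : Prop := ∀ k, ∃ x ∈ X, ¬ x < k

/-- `X` is finite (bounded). -/
def Bounded (X : Set 𝔐.Num) : Prop := ∃ k, ∀ x ∈ X, x < k

/-! ### Weak König's lemma -/

/-- `t` is an initial segment, of length `m`, of the sequence `s`. -/
def IsInit (t m s : 𝔐.Num) : Prop :=
  IsSeq t m ∧ ∀ i, i < m → ∀ x, Entry t i x ↔ Entry s i x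

/-- `T` is a tree of binary strings: closed under initial segments. -/
def IsBinTree (T : Set 𝔐.Num) : Prop :=
  (∀ s ∈ T, ∃ l, IsString s l) ∧
  ∀ s ∈ T, ∀ l m t, IsString s l → (m < l ∨ m = l) → IsInit t m s → t ∈ T

/-- `P`, read as the infinite binary sequence which is `1` exactly at `i ∈ P`, is a path
through `T`. -/
def IsPath (P T : Set 𝔐.Num) : Prop :=
  ∀ l, ∃ s ∈ T, IsString s l ∧ ∀ i, i < l → (Entry s i 1 ↔ i ∈ P)

variable (𝔐) in
/-- Weak König's lemma: every infinite binary tree has a path. -/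
def WKL : Prop :=
  ∀ T ∈ 𝔐.sets, IsBinTree T → Infinite T → ∃ P ∈ 𝔐.sets, IsPath P T

/-! ### Boolean relations inside `𝔐` -/

/-- `c = (n, a)` is the code of a nonempty Boolean relation of arity `n`: `a` is the code of a
nonempty finite set of elements of `{0,1}^n`. -/
def IsRel (c n : 𝔐.Num) : Prop :=
  ∃ a, c = pair n a ∧ IsFinset a ∧ (∃ r, FMem r a) ∧ ∀ r, FMem r a → IsString r n

/-- The vector `r` belongs to the relation `c`. -/
def RelMem (r c : 𝔐.Num) : Prop := ∃ n a, c = pair n a ∧ FMem r a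

/-- For `b ∈ {0,1}`: the relation `c` is `b`-valid, i.e. contains `(b, …, b)`. -/
def RelValid (b c : 𝔐.Num) : Prop :=
  ∃ n r, IsRel c n ∧ RelMem r c ∧ ∀ i, i < n → Entry r i b

/-- For `b ∈ {0,1}`: the relation `c` is `b`-default, i.e. stays closed under changing any one
coordinate to `b`. -/
def RelDefault (b c : 𝔐.Num) : Prop :=
  ∃ n, IsRel c n ∧ ∀ r, RelMem r c → ∀ j, j < n →
    ∃ s, RelMem s c ∧ Entry s j b ∧
      ∀ k, k < n → k ≠ j → ∀ x, Entry s k x ↔ Entry r k x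

/-- `c` is the unary relation `{b}`: it is `[x]` for `b = 1` and `[¬x]` for `b = 0`. -/
def RelIsLiteral (b c : 𝔐.Num) : Prop :=
  IsRel c 1 ∧ ∀ r, RelMem r c ↔ (IsString r 1 ∧ Entry r 0 b)

/-- One of the four conditions (a)-(d), evaluated in `𝔐`, for a class `S` of codes of relations. -/
def EasyClass (S : Set 𝔐.Num) : Prop :=
  (∀ c ∈ S, RelValid 0 c) ∨
  (∀ c ∈ S, RelValid 1 c) ∨
  (∀ c ∈ S, ¬ RelDefault 0 c → RelIsLiteral 1 c) ∨
  (∀ c ∈ S, ¬ RelDefault 1 c → RelIsLiteral 0 c)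

/-! ### The principle `SAT(S)` inside `𝔐` -/

/-- `φ = (c, y)` is the code of an `S`-formula `R(y₁, …, yₙ)` over the set of variables `V`:
`c ∈ S` codes the relation `R` of some arity `n`, and `y` is a sequence of length `n` from `V`. -/
def IsSFormula (S V : Set 𝔐.Num) (φ : 𝔐.Num) : Prop :=
  ∃ c ∈ S, ∃ n y, φ = pair c y ∧ IsRel c n ∧ IsSeq y n ∧ ∀ i x, Entry y i x → x ∈ V

/-- The assignment making exactly the variables in `A` true satisfies `φ = R(y₁, …, yₙ)`: the
vector of the values of `y₁, …, yₙ` is in `R`. -/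
def Satisfies (A : Set 𝔐.Num) (φ : 𝔐.Num) : Prop :=
  ∃ c n y r, φ = pair c y ∧ IsRel c n ∧ IsSeq y n ∧ RelMem r c ∧
    ∀ i x, Entry y i x → (x ∈ A → Entry r i 1) ∧ (x ∉ A → Entry r i 0)

/-- Every finite subset of `C` is satisfied by an assignment of the variables in `V`, given
by its set `A ⊆ V` of true variables. -/
def FinitelySatisfiable (V C : Set 𝔐.Num) : Prop :=
  ∀ F ∈ 𝔐.sets, F ⊆ C → Bounded F → ∃ A ∈ 𝔐.sets, A ⊆ V ∧ ∀ φ ∈ F, Satisfies A φ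

/-- `SAT(S)` in `𝔐`, for an arbitrary class `S` of codes of relations, which need not belong to
the set sort: every finitely satisfiable set `C` of `S`-formulas over an infinite set `V` of
variables is satisfied by an assignment `V → {0,1}`. The sets `V`, `C` and the assignment
range over the set sort of `𝔐`. -/
def SATClass (S : Set 𝔐.Num) : Prop :=
  ∀ V ∈ 𝔐.sets, Infinite V → ∀ C ∈ 𝔐.sets, (∀ φ ∈ C, IsSFormula S V φ) →
    FinitelySatisfiable V C → ∃ A ∈ 𝔐.sets, A ⊆ V ∧ ∀ φ ∈ C, Satisfies A φ

end L2Structure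

/-- `φ` is provable over `RCA₀`: by the completeness theorem, this is truth in all models of
`RCA₀`, with arbitrary number sort and arbitrary set sort. -/
def RCA0Proves (φ : L2Structure.{u} → Prop) : Prop :=
  ∀ 𝔐 : L2Structure.{u}, 𝔐.ModelsRCA0 → φ 𝔐

/-! ### Boolean relations in the metatheory -/

/-- A Boolean relation: a subset of `{0,1}^n` for some arity `n`. -/
structure BoolRel where
  arity : ℕ
  rel : Set (Fin arity → Bool)

namespace BoolRel

/-- `R` contains the constant vector `(b, …, b)`. -/
def Valid (b : Bool) (R : BoolRel) : Prop := (fun _ => b) ∈ R.rel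

/-- `R` is closed under changing any one coordinate to `b`. -/
def Default (b : Bool) (R : BoolRel) : Prop :=
  ∀ r ∈ R.rel, ∀ j, Function.update r j b ∈ R.rel

/-- The unary relation `{b}`: `[x]` for `b = true`, `[¬x]` for `b = false`. -/
def literal (b : Bool) : BoolRel := ⟨1, {fun _ => b}⟩

/-- One of the four conditions (a)-(d) for a set of Boolean relations. -/
def EasySet (S : Set BoolRel) : Prop :=
  (∀ R ∈ S, R.Valid false) ∨
  (∀ R ∈ S, R.Valid true) ∨
  (∀ R ∈ S, ¬ R.Default false → R = literal true) ∨
  (∀ R ∈ S, ¬ R.Default true → R = literal false)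

end BoolRel

namespace L2Structure

variable (𝔐 : L2Structure.{u})

/-- The numeral of `k` in `𝔐`. -/
def numeral : ℕ → 𝔐.Num
  | 0 => 0
  | k + 1 => numeral k + 1

/-- The truth value `b` as an element of `𝔐`. -/
def bit (b : Bool) : 𝔐.Num := if b then 1 else 0

variable {𝔐}

/-- The number `c` of `𝔐` is the code of the Boolean relation `R`. -/
def CodesRel (c : 𝔐.Num) (R : BoolRel) : Prop :=
  IsRel c (𝔐.numeral R.arity) ∧
  ∀ r : Fin R.arity → Bool, r ∈ R.rel ↔
    ∃ s, RelMem s c ∧ ∀ i : Fin R.arity, Entry s (𝔐.numeral i) (𝔐.bit (r i))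

end L2Structure

/-- `SAT(S)` for a set `S` of Boolean relations, as a statement about structures of second-order
arithmetic: an `S`-formula is one whose relation is (the code of) an element of `S`. -/
def SAT (S : Set BoolRel) (𝔐 : L2Structure.{u}) : Prop :=
  L2Structure.SATClass {c : 𝔐.Num | ∃ R ∈ S, L2Structure.CodesRel c R}

/-! Weak König's lemma gives `SATClass S` for every `S` (`satClass_of_wkl`): the strings of length
`l` satisfying all members of `C` with code below `l` form a binary tree, because a variable has a
smaller code than any formula it occurs in. Finite satisfiability makes the tree infinite, and a
path yields a satisfying assignment.

For the easy classes an assignment can be computed outright. Under (a) or (b) it is constant. Under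
(c) or (d), with the literal `[b]` allowed and all other relations closed under changes to `!b`, a
variable gets the value `b` exactly when `C` contains that literal on it (`satClass_of_default`).

For the remaining classes, `SATClass S` yields separation of disjoint enumerated sets, and
separation yields weak König's lemma (`wkl_of_separation`). To separate, the variable `(2, n)` has
to be forced to `b` once `n` is enumerated by `D b`. The constants 0 and 1 are simulated by
variables `(0, s)` and `(1, s)`. There is one copy per stage: the formula for `n` at stage `s`
mentions copy `s`, so both numbers are bounded by its code and the set of formulas is computable,
not merely enumerable (`separation_of_gadgets`). If some relation is neither 0-valid nor 1-valid, it
expresses that two variables differ, which fixes everything up to a global flip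
(`separation_of_not_valid`). Otherwise one relation forces 1, another forces 0, and the failures of
(c) and (d) provide vectors with one entry forced by the others (`separation_of_forced`).

All this happens inside a possibly nonstandard model, so arithmetic, the coding of finite sets and
bounds on codes are derived from the axioms. Membership in the set sort is expressed by the type
classes `RecP` and `RecF`, so instance search supplies most comprehension and induction hypotheses.
The metatheoretic sense follows from the internal one because the four conditions transfer between a
relation and its code (`easyClass_iff_easySet`). -/

set_option synthInstance.maxSize 2000

/-! ### Building terms and bounded formulas -/

instance : Add NumTerm := ⟨.add⟩
instance : Mul NumTerm := ⟨.mul⟩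
instance : Zero NumTerm := ⟨.zero⟩
instance : One NumTerm := ⟨.one⟩

namespace BddFormula

/-- Disjunction. -/
def or (θ η : BddFormula) : BddFormula := .neg (.and (.neg θ) (.neg η))

/-- Implication. -/
def imp (θ η : BddFormula) : BddFormula := .neg (.and θ (.neg η))

/-- Bounded existential quantifier. -/
def bex (i : ℕ) (t : NumTerm) (θ : BddFormula) : BddFormula := .neg (.ball i t (.neg θ))

end BddFormula

namespace NumTerm

/-- The term for the pairing function. -/
def pair (s t : NumTerm) : NumTerm := (s + t) * (s + t) + s

end NumTerm

namespace L2Structure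

/-- Models of `RCA₀`, as a class. -/
class RCA (𝔐 : L2Structure.{u}) : Prop where
  models : 𝔐.ModelsRCA0

/-! ### Truth of terms and of the derived connectives -/

section Semantics

variable {𝔐 : L2Structure.{u}} {E : ℕ → Set 𝔐.Num} {e : ℕ → 𝔐.Num}

instance : Nonempty 𝔐.Num := ⟨0⟩

@[simp] theorem value_var (i : ℕ) : 𝔐.value e (.var i) = e i := rfl
@[simp] theorem value_zero : 𝔐.value e 0 = 0 := rfl
@[simp] theorem value_one : 𝔐.value e 1 = 1 := rfl
@[simp] theorem value_add (s t : NumTerm) : 𝔐.value e (s + t) = 𝔐.value e s + 𝔐.value e t := rfl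
@[simp] theorem value_mul (s t : NumTerm) : 𝔐.value e (s * t) = 𝔐.value e s * 𝔐.value e t := rfl
@[simp] theorem value_pair (s t : NumTerm) :
    𝔐.value e (s.pair t) = pair (𝔐.value e s) (𝔐.value e t) := rfl

@[simp] theorem holds_eq (s t : NumTerm) :
    𝔐.Holds E (.eq s t) e ↔ 𝔐.value e s = 𝔐.value e t := Iff.rfl
@[simp] theorem holds_lt (s t : NumTerm) :
    𝔐.Holds E (.lt s t) e ↔ 𝔐.value e s < 𝔐.value e t := Iff.rfl
@[simp] theorem holds_mem (s : NumTerm) (j : ℕ) :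
    𝔐.Holds E (.mem s j) e ↔ 𝔐.value e s ∈ E j := Iff.rfl
@[simp] theorem holds_neg (θ : BddFormula) : 𝔐.Holds E (.neg θ) e ↔ ¬ 𝔐.Holds E θ e := Iff.rfl
@[simp] theorem holds_and (θ η : BddFormula) :
    𝔐.Holds E (.and θ η) e ↔ 𝔐.Holds E θ e ∧ 𝔐.Holds E η e := Iff.rfl
@[simp] theorem holds_ball (i : ℕ) (t : NumTerm) (θ : BddFormula) :
    𝔐.Holds E (.ball i t θ) e ↔
      ∀ a, a < 𝔐.value e t → 𝔐.Holds E θ (Function.update e i a) := Iff.rfl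
@[simp] theorem holds_or (θ η : BddFormula) :
    𝔐.Holds E (.or θ η) e ↔ 𝔐.Holds E θ e ∨ 𝔐.Holds E η e := by
  simp only [BddFormula.or, holds_neg, holds_and]; tauto
@[simp] theorem holds_imp (θ η : BddFormula) :
    𝔐.Holds E (.imp θ η) e ↔ (𝔐.Holds E θ e → 𝔐.Holds E η e) := by
  simp only [BddFormula.imp, holds_neg, holds_and]; tauto
@[simp] theorem holds_bex (i : ℕ) (t : NumTerm) (θ : BddFormula) :
    𝔐.Holds E (.bex i t θ) e ↔
      ∃ a, a < 𝔐.value e t ∧ 𝔐.Holds E θ (Function.update e i a) := by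
  simp [BddFormula.bex]

/-- An assignment with the parameters `a, b` at places `2, 3`. -/
def params (a b : 𝔐.Num) : ℕ → 𝔐.Num
  | 2 => a
  | _ => b

@[simp] theorem params_two (a b : 𝔐.Num) : params a b 2 = a := rfl
@[simp] theorem params_three (a b : 𝔐.Num) : params a b 3 = b := rfl

end Semantics

variable {𝔐 : L2Structure.{u}} [RCA 𝔐]

/-! ### Arithmetic and order from induction -/

namespace Arith

/-- Set parameters play no role here, so an arbitrary member of the set sort fills every slot. If
variable 1 does not occur in `θ`, the existential quantifier is vacuous; otherwise it carries a
witness, such as a predecessor or a difference. -/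
theorem induction (θ : BddFormula) (e : ℕ → 𝔐.Num)
    (h0 : 𝔐.SigmaHolds (fun _ => 𝔐.sets_nonempty.some) θ e 0)
    (hs : ∀ n, 𝔐.SigmaHolds (fun _ => 𝔐.sets_nonempty.some) θ e n →
      𝔐.SigmaHolds (fun _ => 𝔐.sets_nonempty.some) θ e (n + 1)) (n : 𝔐.Num) :
    𝔐.SigmaHolds (fun _ => 𝔐.sets_nonempty.some) θ e n :=
  RCA.models.sigma_induction θ e _ (fun _ => 𝔐.sets_nonempty.some_mem) h0 hs n

theorem add_zero (a : 𝔐.Num) : a + 0 = a := RCA.models.add_zero a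
theorem add_succ (a b : 𝔐.Num) : a + (b + 1) = (a + b) + 1 := RCA.models.add_succ a b
theorem mul_zero (a : 𝔐.Num) : a * 0 = 0 := RCA.models.mul_zero a
theorem mul_succ (a b : 𝔐.Num) : a * (b + 1) = a * b + a := RCA.models.mul_succ a b
theorem succ_inj {a b : 𝔐.Num} : a + 1 = b + 1 ↔ a = b :=
  ⟨RCA.models.add_one_inj a b, fun h => by rw [h]⟩
theorem succ_ne_zero (a : 𝔐.Num) : a + 1 ≠ 0 := RCA.models.add_one_ne_zero a
theorem not_lt_zero (a : 𝔐.Num) : ¬ a < 0 := RCA.models.not_lt_zero a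
theorem lt_succ {a b : 𝔐.Num} : a < b + 1 ↔ a < b ∨ a = b := RCA.models.lt_succ a b

open NumTerm (var)

theorem add_assoc (a b c : 𝔐.Num) : a + b + c = a + (b + c) := by
  have := induction (.eq (var 2 + var 3 + var 0) (var 2 + (var 3 + var 0))) (params a b)
  simp [SigmaHolds, add_zero, add_succ] at this
  exact this (fun n h => by rw [h]) c

theorem zero_add (a : 𝔐.Num) : 0 + a = a := by
  have := induction (.eq (0 + var 0) (var 0)) (params a a)
  simp [SigmaHolds, add_zero, add_succ] at this
  exact this (fun n h => by rw [h]) a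

theorem succ_add (a b : 𝔐.Num) : a + 1 + b = a + b + 1 := by
  have := induction (.eq (var 2 + 1 + var 0) (var 2 + var 0 + 1)) (params a a)
  simp [SigmaHolds, add_zero, add_succ] at this
  exact this (fun n h => by rw [h]) b

theorem add_comm (a b : 𝔐.Num) : a + b = b + a := by
  have := induction (.eq (var 2 + var 0) (var 0 + var 2)) (params a a)
  simp [SigmaHolds, add_zero, add_succ, succ_add, zero_add] at this
  exact this (fun n h => by rw [h]) b

theorem mul_add (a b c : 𝔐.Num) : a * (b + c) = a * b + a * c := by
  have := induction (.eq (var 2 * (var 3 + var 0)) (var 2 * var 3 + var 2 * var 0)) (params a b)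
  simp [SigmaHolds, add_zero, add_succ, mul_zero, mul_succ] at this
  exact this (fun n h => by rw [h, add_assoc]) c

theorem mul_one (a : 𝔐.Num) : a * 1 = a := by
  rw [← zero_add 1, mul_succ, mul_zero, zero_add]

theorem mul_assoc (a b c : 𝔐.Num) : a * b * c = a * (b * c) := by
  have := induction (.eq (var 2 * var 3 * var 0) (var 2 * (var 3 * var 0))) (params a b)
  simp [SigmaHolds, mul_zero, mul_add] at this
  exact this (fun n h => by rw [h, mul_one, mul_one]) c

theorem zero_mul (a : 𝔐.Num) : 0 * a = 0 := by
  have := induction (.eq (0 * var 0) 0) (params a a)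
  simp [SigmaHolds, add_zero, mul_zero, mul_succ] at this
  exact this a

theorem succ_mul (a b : 𝔐.Num) : (a + 1) * b = a * b + b := by
  have := induction (.eq ((var 2 + 1) * var 0) (var 2 * var 0 + var 0)) (params a a)
  simp [SigmaHolds, add_zero, mul_zero, mul_succ] at this
  exact this (fun n h => by
    rw [h, add_assoc, add_assoc, ← add_assoc n, ← add_assoc a, add_comm n a, add_assoc]) b

theorem mul_comm (a b : 𝔐.Num) : a * b = b * a := by
  have := induction (.eq (var 2 * var 0) (var 0 * var 2)) (params a a)
  simp [SigmaHolds, mul_zero, mul_succ, succ_mul, zero_mul] at this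
  exact this (fun n h => by rw [h]) b

theorem add_right_cancel (a b c : 𝔐.Num) : a + c = b + c → a = b := by
  have := induction (.imp (.eq (var 2 + var 0) (var 3 + var 0)) (.eq (var 2) (var 3))) (params a b)
  simp [SigmaHolds, add_zero, add_succ, succ_inj] at this
  exact this c

theorem eq_zero_or_succ (a : 𝔐.Num) : a = 0 ∨ ∃ b, a = b + 1 := by
  have := induction (.or (.eq (var 0) 0) (.eq (var 0) (var 1 + 1))) (params a a)
  simp only [SigmaHolds] at this
  simp at this
  have h := this (fun n _ _ => ⟨n, .inr rfl⟩) a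
  obtain ⟨b, h | h⟩ := h
  exacts [.inl h, .inr ⟨b, h⟩]

theorem lt_add_succ (a b : 𝔐.Num) : a < a + (b + 1) := by
  have := induction (.lt (var 2) (var 2 + (var 0 + 1))) (params a a)
  simp [SigmaHolds] at this
  refine this ?_ ?_ b
  · rw [add_succ, add_zero]; exact lt_succ.2 (.inr rfl)
  · intro n h; rw [add_succ]; exact lt_succ.2 (.inl h)

theorem exists_of_lt {a b : 𝔐.Num} (h : a < b) : ∃ c, b = a + (c + 1) := by
  have := induction (.imp (.lt (var 2) (var 0)) (.eq (var 0) (var 2 + (var 1 + 1)))) (params a a)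
  simp only [SigmaHolds] at this
  simp at this
  obtain ⟨c, hc⟩ := this 0 (fun h => absurd h (not_lt_zero _)) (fun n c hc => by
    by_cases hn : a < n
    · exact ⟨c + 1, fun _ => by nth_rewrite 1 [hc hn]; rw [← add_succ]⟩
    · refine ⟨0, fun h => ?_⟩
      rw [lt_succ] at h
      rw [h.resolve_left hn, zero_add]) b
  exact ⟨c, hc h⟩

theorem lt_iff {a b : 𝔐.Num} : a < b ↔ ∃ c, b = a + (c + 1) :=
  ⟨exists_of_lt, by rintro ⟨c, rfl⟩; exact lt_add_succ a c⟩

theorem lt_irrefl (a : 𝔐.Num) : ¬ a < a := by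
  intro h
  obtain ⟨c, hc⟩ := exists_of_lt h
  have : 0 + a = (c + 1) + a := by rw [zero_add, add_comm _ a, ← hc]
  exact succ_ne_zero c (add_right_cancel _ _ _ this).symm

theorem lt_trans {a b c : 𝔐.Num} (h : a < b) (h' : b < c) : a < c := by
  obtain ⟨x, rfl⟩ := exists_of_lt h
  obtain ⟨y, rfl⟩ := exists_of_lt h'
  rw [add_assoc, add_succ]
  exact lt_iff.2 ⟨x + 1 + y, rfl⟩

theorem trichotomy (a b : 𝔐.Num) : a < b ∨ a = b ∨ b < a := by
  have := induction (.or (.lt (var 2) (var 0)) (.or (.eq (var 2) (var 0)) (.lt (var 0) (var 2))))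
    (params a a)
  simp [SigmaHolds] at this
  refine this ?_ ?_ b
  · obtain rfl | ⟨c, rfl⟩ := eq_zero_or_succ a
    · exact .inr (.inl rfl)
    · exact .inr (.inr (lt_iff.2 ⟨c, by rw [zero_add]⟩))
  · rintro n (h | rfl | h)
    · exact .inl (lt_succ.2 (.inl h))
    · exact .inl (lt_succ.2 (.inr rfl))
    · obtain ⟨c, rfl⟩ := exists_of_lt h
      obtain rfl | ⟨d, rfl⟩ := eq_zero_or_succ c
      · exact .inr (.inl (by rw [zero_add]))
      · refine .inr (.inr (lt_iff.2 ⟨d, ?_⟩))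
        rw [add_succ, succ_add]

end Arith

/-! ### The number sort as an ordered semiring -/

instance : CommSemiring 𝔐.Num where
  add_assoc := Arith.add_assoc
  zero_add := Arith.zero_add
  add_zero := Arith.add_zero
  add_comm := Arith.add_comm
  left_distrib := Arith.mul_add
  right_distrib a b c := by
    rw [Arith.mul_comm, Arith.mul_add, Arith.mul_comm a, Arith.mul_comm b]
  zero_mul := Arith.zero_mul
  mul_zero := Arith.mul_zero
  mul_assoc := Arith.mul_assoc
  one_mul a := by rw [Arith.mul_comm, Arith.mul_one]
  mul_one := Arith.mul_one
  mul_comm := Arith.mul_comm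
  nsmul := nsmulRec

instance : LE 𝔐.Num := ⟨fun a b => a < b ∨ a = b⟩

omit [RCA 𝔐] in
theorem le_iff_lt_or_eq' {a b : 𝔐.Num} : a ≤ b ↔ a < b ∨ a = b := Iff.rfl

noncomputable instance : LinearOrder 𝔐.Num where
  le_refl a := .inr rfl
  le_trans := by
    rintro a b c (h | rfl) (h' | rfl)
    exacts [.inl (Arith.lt_trans h h'), .inl h, .inl h', .inr rfl]
  le_antisymm := by
    rintro a b (h | rfl) (h' | h')
    exacts [absurd (Arith.lt_trans h h') (Arith.lt_irrefl a), h'.symm, rfl, rfl]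
  lt_iff_le_not_ge a b := by
    constructor
    · refine fun h => ⟨.inl h, ?_⟩
      rintro (h' | rfl)
      exacts [Arith.lt_irrefl a (Arith.lt_trans h h'), Arith.lt_irrefl b h]
    · rintro ⟨h | rfl, h'⟩
      exacts [h, absurd (.inr rfl) h']
  le_total a b := by
    rcases Arith.trichotomy a b with h | rfl | h
    exacts [.inl (.inl h), .inl (.inr rfl), .inr (.inl h)]
  toDecidableLE := Classical.decRel _

theorem lt_iff_exists_add_succ {a b : 𝔐.Num} : a < b ↔ ∃ c, b = a + (c + 1) := Arith.lt_iff

theorem lt_add_one_iff {a b : 𝔐.Num} : a < b + 1 ↔ a ≤ b := Arith.lt_succ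

theorem eq_zero_or_eq_succ (a : 𝔐.Num) : a = 0 ∨ ∃ b, a = b + 1 := Arith.eq_zero_or_succ a

theorem succ_le_iff {a b : 𝔐.Num} : a + 1 ≤ b ↔ a < b := by
  rw [lt_iff_exists_add_succ, le_iff_lt_or_eq', lt_iff_exists_add_succ]
  constructor
  · rintro (⟨c, rfl⟩ | rfl)
    exacts [⟨c + 1, by ring⟩, ⟨0, by ring⟩]
  · rintro ⟨c, rfl⟩
    obtain rfl | ⟨d, rfl⟩ := eq_zero_or_eq_succ c
    exacts [.inr (by ring), .inl ⟨d, by ring⟩]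

instance : IsCancelAdd 𝔐.Num where
  add_left_cancel a b c h := by
    have h : a + b = a + c := h
    rw [add_comm a, add_comm a] at h
    exact Arith.add_right_cancel _ _ _ h
  add_right_cancel a b c h := Arith.add_right_cancel _ _ _ h

instance : IsStrictOrderedRing 𝔐.Num where
  add_le_add_left := by
    rintro a b (h | rfl) c
    · obtain ⟨d, rfl⟩ := lt_iff_exists_add_succ.1 h
      exact .inl (lt_iff_exists_add_succ.2 ⟨d, by ring⟩)
    · exact le_rfl
  le_of_add_le_add_left a b c := by
    rintro (h | h)
    · obtain ⟨d, hd⟩ := lt_iff_exists_add_succ.1 h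
      rw [add_assoc] at hd
      exact .inl (lt_iff_exists_add_succ.2 ⟨d, add_left_cancel hd⟩)
    · exact .inr (add_left_cancel h)
  zero_le_one := .inl (lt_iff_exists_add_succ.2 ⟨0, by ring⟩)
  exists_pair_ne := ⟨0, 1, fun h => Arith.succ_ne_zero (0 : 𝔐.Num) (by rw [← h]; ring)⟩
  mul_lt_mul_of_pos_left a ha b c h := by
    obtain ⟨d, rfl⟩ := lt_iff_exists_add_succ.1 h
    obtain ⟨x, rfl⟩ := lt_iff_exists_add_succ.1 ha
    exact lt_iff_exists_add_succ.2 ⟨x * d + x + d, by ring⟩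
  mul_lt_mul_of_pos_right a ha b c h := by
    obtain ⟨d, rfl⟩ := lt_iff_exists_add_succ.1 h
    obtain ⟨x, rfl⟩ := lt_iff_exists_add_succ.1 ha
    exact lt_iff_exists_add_succ.2 ⟨x * d + x + d, by ring⟩

instance : CanonicallyOrderedAdd 𝔐.Num where
  exists_add_of_le := by
    rintro a b (h | rfl)
    · obtain ⟨d, rfl⟩ := lt_iff_exists_add_succ.1 h
      exact ⟨_, rfl⟩
    · exact ⟨0, (add_zero _).symm⟩
  le_add_self a b := by
    obtain rfl | ⟨c, rfl⟩ := eq_zero_or_eq_succ b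
    exacts [.inr (by ring), .inl (lt_iff_exists_add_succ.2 ⟨c, by ring⟩)]
  le_self_add a b := by
    obtain rfl | ⟨c, rfl⟩ := eq_zero_or_eq_succ b
    exacts [.inr (by ring), .inl (lt_iff_exists_add_succ.2 ⟨c, by ring⟩)]

/-! ### Pairing -/

theorem left_le_pair (i j : 𝔐.Num) : i ≤ pair i j := le_add_self

theorem right_le_pair (i j : 𝔐.Num) : j ≤ pair i j := by
  obtain rfl | ⟨k, rfl⟩ := eq_zero_or_eq_succ j
  · exact zero_le
  · have : pair i (k + 1) = k + 1 + (k * k + k + 2 * i * k + i * i + 3 * i) := by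
      rw [pair]; ring
    rw [this]
    exact le_self_add

/-- Since `(i + j)² + i < (i + j + 1)²`, all codes with one value of `i + j` precede those with a
larger value. Injectivity of `pair` rests on this. -/
theorem pair_lt_of_add_lt {i j k l : 𝔐.Num} (h : i + j < k + l) : pair i j < pair k l := by
  obtain ⟨d, hd⟩ := lt_iff_exists_add_succ.1 h
  rw [pair, pair, hd]
  refine lt_iff_exists_add_succ.2 ⟨i + j + j + d * d + d + d + 2 * (i + j) * d + k, ?_⟩
  ring

theorem pair_inj {i j k l : 𝔐.Num} : pair i j = pair k l ↔ i = k ∧ j = l := by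
  refine ⟨fun h => ?_, by rintro ⟨rfl, rfl⟩; rfl⟩
  rcases lt_trichotomy (i + j) (k + l) with h' | h' | h'
  · exact absurd h (pair_lt_of_add_lt h').ne
  · rw [pair, pair, h'] at h
    obtain rfl := add_left_cancel h
    exact ⟨rfl, add_left_cancel h'⟩
  · exact absurd h (pair_lt_of_add_lt h').ne'

theorem pair_le_pair {i j k l : 𝔐.Num} (h : i ≤ k) (h' : j ≤ l) : pair i j ≤ pair k l := by
  unfold pair; gcongr

theorem pair_lt_pair {i j k l : 𝔐.Num} (h : i < k) (h' : j ≤ l) : pair i j < pair k l :=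
  pair_lt_of_add_lt (add_lt_add_of_lt_of_le h h')

open Classical in
/-- First component of a pair, and `0` if the number is not a pair. -/
noncomputable def fst (p : 𝔐.Num) : 𝔐.Num := if h : ∃ i j, p = pair i j then h.choose else 0

open Classical in
/-- Second component of a pair, and `0` if the number is not a pair. -/
noncomputable def snd (p : 𝔐.Num) : 𝔐.Num := if h : ∃ j i, p = pair i j then h.choose else 0

@[simp] theorem fst_pair (i j : 𝔐.Num) : fst (pair i j) = i := by
  have h : ∃ i' j', pair i j = pair i' j' := ⟨i, j, rfl⟩
  rw [fst, dif_pos h]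
  obtain ⟨j', hj⟩ := h.choose_spec
  exact (pair_inj.1 hj).1.symm

@[simp] theorem snd_pair (i j : 𝔐.Num) : snd (pair i j) = j := by
  have h : ∃ j' i', pair i j = pair i' j' := ⟨j, i, rfl⟩
  rw [snd, dif_pos h]
  obtain ⟨j', hj⟩ := h.choose_spec
  exact (pair_inj.1 hj).2.symm

/-- Components do not exceed their pair, so the graph of `fst`, default value included, has a
bounded description. -/
theorem fst_eq_iff {p a : 𝔐.Num} :
    fst p = a ↔ (∃ j < p + 1, p = pair a j) ∨
      (a = 0 ∧ ¬ ∃ i < p + 1, ∃ j < p + 1, p = pair i j) := by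
  by_cases h : ∃ i j, p = pair i j
  · obtain ⟨i, j, rfl⟩ := h
    have hi : i < pair i j + 1 := lt_add_one_iff.2 (left_le_pair i j)
    have hj : j < pair i j + 1 := lt_add_one_iff.2 (right_le_pair i j)
    rw [fst_pair]
    constructor
    · rintro rfl; exact .inl ⟨j, hj, rfl⟩
    · rintro (⟨j', -, h⟩ | ⟨-, h⟩)
      exacts [(pair_inj.1 h).1, absurd ⟨i, hi, j, hj, rfl⟩ h]
  · rw [fst, dif_neg h]
    constructor
    · rintro rfl
      exact .inr ⟨rfl, fun ⟨i, _, j, _, e⟩ => h ⟨i, j, e⟩⟩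
    · rintro (⟨j, -, e⟩ | ⟨e, -⟩)
      exacts [absurd ⟨a, j, e⟩ h, e.symm]

theorem snd_eq_iff {p a : 𝔐.Num} :
    snd p = a ↔ (∃ i < p + 1, p = pair i a) ∨
      (a = 0 ∧ ¬ ∃ i < p + 1, ∃ j < p + 1, p = pair i j) := by
  by_cases h : ∃ j i, p = pair i j
  · obtain ⟨j, i, rfl⟩ := h
    have hi : i < pair i j + 1 := lt_add_one_iff.2 (left_le_pair i j)
    have hj : j < pair i j + 1 := lt_add_one_iff.2 (right_le_pair i j)
    rw [snd_pair]
    constructor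
    · rintro rfl; exact .inl ⟨i, hi, rfl⟩
    · rintro (⟨i', -, h⟩ | ⟨-, h⟩)
      exacts [(pair_inj.1 h).2, absurd ⟨i, hi, j, hj, rfl⟩ h]
  · rw [snd, dif_neg h]
    constructor
    · rintro rfl
      exact .inr ⟨rfl, fun ⟨i, _, j, _, e⟩ => h ⟨j, i, e⟩⟩
    · rintro (⟨j, -, e⟩ | ⟨e, -⟩)
      exacts [absurd ⟨a, j, e⟩ h, e.symm]

theorem exists_eq_pair_bdd {a b : 𝔐.Num} {Q : 𝔐.Num → 𝔐.Num → Prop} :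
    (∃ i < pair a b + 1, ∃ j < pair a b + 1, pair a b = pair i j ∧ Q i j) ↔ Q a b := by
  constructor
  · rintro ⟨i, -, j, -, h, hQ⟩
    obtain ⟨rfl, rfl⟩ := pair_inj.1 h
    exact hQ
  · exact fun h => ⟨a, lt_add_one_iff.2 (left_le_pair _ _), b,
      lt_add_one_iff.2 (right_le_pair _ _), rfl, h⟩

/-! ### Recursive predicates and functions -/

/-- The predicate `P` defines a set of the model. -/
class RecP (P : 𝔐.Num → Prop) : Prop where
  mem_sets : {a | P a} ∈ 𝔐.sets

/-- The graph of the function `f` is, as far as pairs are concerned, a set of the model. -/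
class RecF (f : 𝔐.Num → 𝔐.Num) : Prop where
  graph : ∃ G ∈ 𝔐.sets, ∀ a b, pair a b ∈ G ↔ f a = b

/-- The assignment `X, Y` of the set variables. -/
def setParams (X Y : Set 𝔐.Num) : ℕ → Set 𝔐.Num
  | 0 => X
  | _ => Y

omit [RCA 𝔐] in
@[simp] theorem setParams_zero (X Y : Set 𝔐.Num) : setParams X Y 0 = X := rfl
omit [RCA 𝔐] in
@[simp] theorem setParams_one (X Y : Set 𝔐.Num) : setParams X Y 1 = Y := rfl

omit [RCA 𝔐] in
theorem setParams_mem {X Y : Set 𝔐.Num} (hX : X ∈ 𝔐.sets) (hY : Y ∈ 𝔐.sets) (j : ℕ) :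
    setParams X Y j ∈ 𝔐.sets := by
  rcases j with _ | j
  exacts [hX, hY]

/-! ### Closure properties from comprehension -/

section Comprehension

variable {X Y : Set 𝔐.Num}

/-- The interface to `Δ⁰₁` comprehension: variable 0 is the argument, variable 1 the unbounded
witness, and two set parameters suffice throughout. -/
theorem RecP.of_delta (hX : X ∈ 𝔐.sets) (hY : Y ∈ 𝔐.sets) (θ η : BddFormula) (e : ℕ → 𝔐.Num)
    {P Q : 𝔐.Num → 𝔐.Num → Prop} {R : 𝔐.Num → Prop}
    (hθ : ∀ n b, 𝔐.Holds (setParams X Y) θ (Function.update (Function.update e 0 n) 1 b) ↔ P n b)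
    (hη : ∀ n b, 𝔐.Holds (setParams X Y) η (Function.update (Function.update e 0 n) 1 b) ↔ Q n b)
    (hP : ∀ n, R n ↔ ∃ b, P n b) (hQ : ∀ n, R n ↔ ∀ b, Q n b) : RecP R := by
  obtain ⟨Z, hZ, h⟩ := RCA.models.delta_comprehension θ η e _ (setParams_mem hX hY)
    (fun n => by simp only [SigmaHolds, PiHolds, hθ, hη, ← hP, ← hQ])
  have : {a | R a} = Z := by
    ext n
    rw [h, SigmaHolds, Set.mem_ofPred_eq, hP]
    simp only [hθ]
  exact ⟨this ▸ hZ⟩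

theorem RecP.of_bdd (hX : X ∈ 𝔐.sets) (hY : Y ∈ 𝔐.sets) (θ : BddFormula) (e : ℕ → 𝔐.Num)
    {P : 𝔐.Num → Prop}
    (hθ : ∀ n b, 𝔐.Holds (setParams X Y) θ (Function.update (Function.update e 0 n) 1 b) ↔ P n) :
    RecP P :=
  RecP.of_delta hX hY θ θ e hθ hθ (by simp) (by simp)

omit [RCA 𝔐] in
theorem RecP.congr {P Q : 𝔐.Num → Prop} (h : RecP P) (e : ∀ a, P a ↔ Q a) : RecP Q := by
  obtain rfl : P = Q := funext fun a => propext (e a)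
  exact h

/-- The formula `∃ x₂ x₃ ≤ x₀, x₀ = (x₂, x₃) ∧ θ`. -/
def _root_.BddFormula.onPair (θ : BddFormula) : BddFormula :=
  .bex 2 (.var 0 + 1) (.bex 3 (.var 0 + 1) (.and (.eq (.var 0) (.pair (.var 2) (.var 3))) θ))

theorem RecF.of_bdd (hX : X ∈ 𝔐.sets) (hY : Y ∈ 𝔐.sets) (θ : BddFormula) (e : ℕ → 𝔐.Num)
    {f : 𝔐.Num → 𝔐.Num}
    (hθ : ∀ n b x y, 𝔐.Holds (setParams X Y) θ (Function.update (Function.update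
      (Function.update (Function.update e 0 n) 1 b) 2 x) 3 y) ↔ f x = y) : RecF f := by
  have := RecP.of_bdd hX hY θ.onPair e (P := fun n => ∃ i < n + 1, ∃ j < n + 1, n = pair i j ∧
    f i = j) (fun n b => by simp [BddFormula.onPair, hθ])
  exact ⟨_, this.mem_sets, fun a b => exists_eq_pair_bdd⟩

omit [RCA 𝔐] in
theorem nonempty_sets : ∃ X, X ∈ 𝔐.sets := 𝔐.sets_nonempty

instance RecP.not {P : 𝔐.Num → Prop} [h : RecP P] : RecP (fun a => ¬ P a) :=
  RecP.of_bdd h.mem_sets h.mem_sets (.neg (.mem (.var 0) 0)) (params 0 0)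
    (by simp)

instance RecP.and {P Q : 𝔐.Num → Prop} [h : RecP P] [h' : RecP Q] :
    RecP (fun a => P a ∧ Q a) :=
  RecP.of_bdd h.mem_sets h'.mem_sets (.and (.mem (.var 0) 0) (.mem (.var 0) 1)) (params 0 0)
    (by simp)

instance RecP.or {P Q : 𝔐.Num → Prop} [RecP P] [RecP Q] : RecP (fun a => P a ∨ Q a) :=
  RecP.congr (P := fun a => ¬ (¬ P a ∧ ¬ Q a)) inferInstance (by intro a; tauto)

instance RecP.imp {P Q : 𝔐.Num → Prop} [RecP P] [RecP Q] : RecP (fun a => P a → Q a) :=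
  RecP.congr (P := fun a => ¬ (P a ∧ ¬ Q a)) inferInstance (by intro a; tauto)

instance RecP.iff {P Q : 𝔐.Num → Prop} [RecP P] [RecP Q] : RecP (fun a => P a ↔ Q a) :=
  RecP.congr (P := fun a => (P a → Q a) ∧ (Q a → P a)) inferInstance (by intro a; tauto)

/-- The defined set is everything or nothing, so `p` may be any metatheoretic statement, whether or
not it is expressible in the language. -/
instance RecP.const (p : Prop) : RecP (fun _ : 𝔐.Num => p) := by
  obtain ⟨X, hX⟩ := nonempty_sets (𝔐 := 𝔐)
  by_cases hp : p
  · exact RecP.of_bdd hX hX (.eq 0 0) (params 0 0) (by simp [hp])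
  · exact RecP.of_bdd hX hX (.neg (.eq 0 0)) (params 0 0) (by simp [hp])

/-- A total single-valued graph gives both forms: `P (f a)` says that some `b` with `f a = b`
satisfies `P`, and equally that every such `b` does. -/
theorem RecP.comp {P : 𝔐.Num → Prop} {f : 𝔐.Num → 𝔐.Num} (h : RecP P) (hf : RecF f) :
    RecP (fun a => P (f a)) := by
  obtain ⟨G, hG, hfG⟩ := hf.graph
  exact RecP.of_delta hG h.mem_sets
    (.and (.mem (.pair (.var 0) (.var 1)) 0) (.mem (.var 1) 1))
    (.imp (.mem (.pair (.var 0) (.var 1)) 0) (.mem (.var 1) 1)) (params 0 0)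
    (P := fun a b => f a = b ∧ P b) (Q := fun a b => f a = b → P b)
    (by simp [hfG]) (by simp [hfG])
    (by simp) (by simp)

instance RecF.id : RecF (fun a : 𝔐.Num => a) := by
  obtain ⟨X, hX⟩ := nonempty_sets (𝔐 := 𝔐)
  exact RecF.of_bdd hX hX (.eq (.var 2) (.var 3)) (params 0 0) (by simp)

instance RecF.const (c : 𝔐.Num) : RecF (fun _ : 𝔐.Num => c) := by
  obtain ⟨X, hX⟩ := nonempty_sets (𝔐 := 𝔐)
  exact RecF.of_bdd hX hX (.eq (.var 4) (.var 3)) (fun _ => c) (by simp)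

instance RecF.fst_id : RecF (fst : 𝔐.Num → 𝔐.Num) := by
  obtain ⟨X, hX⟩ := nonempty_sets (𝔐 := 𝔐)
  refine RecF.of_bdd hX hX (.or (.bex 4 (.var 2 + 1) (.eq (.var 2) (.pair (.var 3) (.var 4))))
    (.and (.eq (.var 3) 0) (.neg (.bex 4 (.var 2 + 1) (.bex 5 (.var 2 + 1)
      (.eq (.var 2) (.pair (.var 4) (.var 5)))))))) (params 0 0) ?_
  intro n b x y
  rw [fst_eq_iff]
  simp

instance RecF.snd_id : RecF (snd : 𝔐.Num → 𝔐.Num) := by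
  obtain ⟨X, hX⟩ := nonempty_sets (𝔐 := 𝔐)
  refine RecF.of_bdd hX hX (.or (.bex 4 (.var 2 + 1) (.eq (.var 2) (.pair (.var 4) (.var 3))))
    (.and (.eq (.var 3) 0) (.neg (.bex 4 (.var 2 + 1) (.bex 5 (.var 2 + 1)
      (.eq (.var 2) (.pair (.var 4) (.var 5)))))))) (params 0 0) ?_
  intro n b x y
  rw [snd_eq_iff]
  simp

theorem RecF.comp {g f : 𝔐.Num → 𝔐.Num} (hg : RecF g) (hf : RecF f) :
    RecF (fun a => g (f a)) := by
  obtain ⟨F, hF, hfF⟩ := hf.graph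
  obtain ⟨G, hG, hgG⟩ := hg.graph
  have := RecP.of_delta hF hG
    (.onPair (.and (.mem (.pair (.var 2) (.var 1)) 0) (.mem (.pair (.var 1) (.var 3)) 1)))
    (.onPair (.imp (.mem (.pair (.var 2) (.var 1)) 0) (.mem (.pair (.var 1) (.var 3)) 1)))
    (params 0 0)
    (P := fun n b => ∃ x < n + 1, ∃ y < n + 1, n = pair x y ∧ f x = b ∧ g b = y)
    (Q := fun n b => ∃ x < n + 1, ∃ y < n + 1, n = pair x y ∧ (f x = b → g b = y))
    (R := fun n => ∃ x < n + 1, ∃ y < n + 1, n = pair x y ∧ g (f x) = y)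
    (by simp [BddFormula.onPair, hfF, hgG])
    (by simp [BddFormula.onPair, hfF, hgG])
    (fun n => ⟨fun ⟨x, hx, y, hy, e, h⟩ => ⟨f x, x, hx, y, hy, e, rfl, h⟩,
      fun ⟨b, x, hx, y, hy, e, h, h'⟩ => ⟨x, hx, y, hy, e, h ▸ h'⟩⟩)
    (fun n => ⟨fun ⟨x, hx, y, hy, e, h⟩ b => ⟨x, hx, y, hy, e, fun hb => hb ▸ h⟩, fun h => by
      -- The instance at 0 serves only to decode `n`; the instance at `f x` then gives the value.
      obtain ⟨x, hx, y, hy, rfl, -⟩ := h 0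
      obtain ⟨x', hx', y', hy', e', h'⟩ := h (f x)
      obtain ⟨rfl, rfl⟩ := pair_inj.1 e'
      exact ⟨x, hx, y, hy, rfl, h' rfl⟩⟩)
  exact ⟨_, this.mem_sets, fun a b => exists_eq_pair_bdd⟩

instance RecF.fst {f : 𝔐.Num → 𝔐.Num} [h : RecF f] : RecF (fun a => fst (f a)) := fst_id.comp h

instance RecF.snd {f : 𝔐.Num → 𝔐.Num} [h : RecF f] : RecF (fun a => snd (f a)) := snd_id.comp h

instance RecF.pair {f g : 𝔐.Num → 𝔐.Num} [hf : RecF f] [hg : RecF g] :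
    RecF (fun a => pair (f a) (g a)) := by
  obtain ⟨F, hF, hfF⟩ := hf.graph
  obtain ⟨G, hG, hgG⟩ := hg.graph
  refine RecF.of_bdd hF hG (.bex 4 (.var 3 + 1) (.bex 5 (.var 3 + 1)
    (.and (.eq (.var 3) (.pair (.var 4) (.var 5)))
      (.and (.mem (.pair (.var 2) (.var 4)) 0) (.mem (.pair (.var 2) (.var 5)) 1))))) (params 0 0) ?_
  intro n b x y
  simp only [holds_bex, holds_and, holds_eq, holds_mem, value_pair, value_var, value_add, value_one,
    setParams_zero, setParams_one, Function.update_apply, hfF, hgG]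
  simp
  constructor
  · rintro ⟨i, -, j, -, rfl, rfl, rfl⟩; rfl
  · rintro rfl
    exact ⟨lt_add_one_iff.2 (left_le_pair _ _), lt_add_one_iff.2 (right_le_pair _ _), rfl⟩

/-- Covers the eta-reduced form of `fun a => pair c a`. -/
instance RecF.pair_const (c : 𝔐.Num) : RecF (L2Structure.pair c) :=
  RecF.pair (f := fun _ => c) (g := fun a => a)

/-- A binary relation whose restriction to pairs is recursive. -/
theorem RecP.of_pair_bdd (hX : X ∈ 𝔐.sets) (hY : Y ∈ 𝔐.sets) (θ : BddFormula) (e : ℕ → 𝔐.Num)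
    {P : 𝔐.Num → 𝔐.Num → Prop}
    (hθ : ∀ n b x y, 𝔐.Holds (setParams X Y) θ (Function.update (Function.update
      (Function.update (Function.update e 0 n) 1 b) 2 x) 3 y) ↔ P x y)
    (f g : 𝔐.Num → 𝔐.Num) [RecF f] [RecF g] : RecP (fun a => P (f a) (g a)) := by
  have := RecP.of_bdd hX hY θ.onPair e (P := fun n => ∃ i < n + 1, ∃ j < n + 1, n = L2Structure.pair i j ∧
    P i j) (fun n b => by simp [BddFormula.onPair, hθ])
  exact (this.comp (f := fun a => L2Structure.pair (f a) (g a)) inferInstance).congr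
    fun a => exists_eq_pair_bdd

instance RecP.eq {f g : 𝔐.Num → 𝔐.Num} [RecF f] [RecF g] : RecP (fun a => f a = g a) := by
  obtain ⟨X, hX⟩ := nonempty_sets (𝔐 := 𝔐)
  exact RecP.of_pair_bdd hX hX (.eq (.var 2) (.var 3)) (params 0 0) (by simp)
    f g

instance RecP.eq_const (c : 𝔐.Num) : RecP (Eq c) := RecP.eq (f := fun _ => c) (g := fun a => a)

instance RecP.lt {f g : 𝔐.Num → 𝔐.Num} [RecF f] [RecF g] : RecP (fun a => f a < g a) := by
  obtain ⟨X, hX⟩ := nonempty_sets (𝔐 := 𝔐)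
  exact RecP.of_pair_bdd hX hX (.lt (.var 2) (.var 3)) (params 0 0) (by simp)
    f g

instance RecP.lt_const (c : 𝔐.Num) : RecP (LT.lt c) := RecP.lt (f := fun _ => c) (g := fun a => a)

instance RecP.le {f g : 𝔐.Num → 𝔐.Num} [RecF f] [RecF g] : RecP (fun a => f a ≤ g a) :=
  RecP.congr (P := fun a => ¬ g a < f a) inferInstance (by simp)

theorem RecF.of_graph {f : 𝔐.Num → 𝔐.Num}
    (h : RecP (fun p => f (L2Structure.fst p) = L2Structure.snd p)) : RecF f :=
  ⟨_, h.mem_sets, fun a b => by simp⟩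

instance RecF.add {f g : 𝔐.Num → 𝔐.Num} [RecF f] [RecF g] : RecF (fun a => f a + g a) := by
  obtain ⟨X, hX⟩ := nonempty_sets (𝔐 := 𝔐)
  have : RecF (fun p : 𝔐.Num => L2Structure.fst p + L2Structure.snd p) := by
    refine RecF.of_graph ?_
    have h := RecP.of_pair_bdd hX hX (.bex 4 (.var 2 + 1) (.bex 5 (.var 2 + 1)
      (.and (.eq (.var 2) (.pair (.var 4) (.var 5))) (.eq (.var 4 + .var 5) (.var 3))))) (params 0 0)
      (P := fun x y => ∃ i < x + 1, ∃ j < x + 1, x = L2Structure.pair i j ∧ i + j = y)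
      (by simp)
      -- `fst p` need not be a pair; rebuilding it from its components makes the bounded decoding in
      -- the formula return exactly those.
      (fun p => L2Structure.pair (L2Structure.fst (L2Structure.fst p))
        (L2Structure.snd (L2Structure.fst p))) (fun p => L2Structure.snd p)
    simpa only [exists_eq_pair_bdd] using h
  simpa using this.comp (f := fun a => L2Structure.pair (f a) (g a)) inferInstance

instance RecF.mul {f g : 𝔐.Num → 𝔐.Num} [RecF f] [RecF g] : RecF (fun a => f a * g a) := by
  obtain ⟨X, hX⟩ := nonempty_sets (𝔐 := 𝔐)
  have : RecF (fun p : 𝔐.Num => L2Structure.fst p * L2Structure.snd p) := by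
    refine RecF.of_graph ?_
    have h := RecP.of_pair_bdd hX hX (.bex 4 (.var 2 + 1) (.bex 5 (.var 2 + 1)
      (.and (.eq (.var 2) (.pair (.var 4) (.var 5))) (.eq (.var 4 * .var 5) (.var 3))))) (params 0 0)
      (P := fun x y => ∃ i < x + 1, ∃ j < x + 1, x = L2Structure.pair i j ∧ i * j = y)
      (by simp)
      (fun p => L2Structure.pair (L2Structure.fst (L2Structure.fst p))
        (L2Structure.snd (L2Structure.fst p))) (fun p => L2Structure.snd p)
    simpa only [exists_eq_pair_bdd] using h
  simpa using this.comp (f := fun a => L2Structure.pair (f a) (g a)) inferInstance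

instance RecP.mem {X : Set 𝔐.Num} [h : RecP (fun a => a ∈ X)] {f : 𝔐.Num → 𝔐.Num} [hf : RecF f] :
    RecP (fun a => f a ∈ X) := h.comp hf

omit [RCA 𝔐] in
theorem RecP.of_mem {X : Set 𝔐.Num} (h : X ∈ 𝔐.sets) : RecP (fun a => a ∈ X) := ⟨h⟩

/-- The bound `f a` is not a term of the language, so it becomes the witness `b`, quantified
existentially in one form and universally in the other; the quantifier over `x < b` stays bounded.
-/
instance RecP.ball {f : 𝔐.Num → 𝔐.Num} {P : 𝔐.Num → 𝔐.Num → Prop} [hf : RecF f]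
    [h : RecP (fun p => P (L2Structure.fst p) (L2Structure.snd p))] :
    RecP (fun a => ∀ x, x < f a → P a x) := by
  obtain ⟨G, hG, hfG⟩ := hf.graph
  have hm : ∀ a b, L2Structure.pair a b ∈ {p | P (L2Structure.fst p) (L2Structure.snd p)} ↔ P a b := by simp
  exact RecP.of_delta hG h.mem_sets
    (.and (.mem (.pair (.var 0) (.var 1)) 0) (.ball 2 (.var 1) (.mem (.pair (.var 0) (.var 2)) 1)))
    (.imp (.mem (.pair (.var 0) (.var 1)) 0) (.ball 2 (.var 1) (.mem (.pair (.var 0) (.var 2)) 1)))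
    (params 0 0)
    (P := fun a b => f a = b ∧ ∀ x, x < b → P a x) (Q := fun a b => f a = b → ∀ x, x < b → P a x)
    (by simp [hfG]) (by simp [hfG])
    (by simp) (by simp)

instance RecP.ball_le {f : 𝔐.Num → 𝔐.Num} {P : 𝔐.Num → 𝔐.Num → Prop} [RecF f]
    [RecP (fun p => P (L2Structure.fst p) (L2Structure.snd p))] :
    RecP (fun a => ∀ x, x ≤ f a → P a x) :=
  RecP.congr (P := fun a => ∀ x, x < f a + 1 → P a x) inferInstance (by simp [lt_add_one_iff])

instance RecP.bex {f : 𝔐.Num → 𝔐.Num} {P : 𝔐.Num → 𝔐.Num → Prop} [RecF f]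
    [RecP (fun p => P (L2Structure.fst p) (L2Structure.snd p))] :
    RecP (fun a => ∃ x, x < f a ∧ P a x) :=
  RecP.congr (P := fun a => ¬ ∀ x, x < f a → ¬ P a x) inferInstance (by simp)

instance RecP.bex_le {f : 𝔐.Num → 𝔐.Num} {P : 𝔐.Num → 𝔐.Num → Prop} [RecF f]
    [RecP (fun p => P (L2Structure.fst p) (L2Structure.snd p))] :
    RecP (fun a => ∃ x, x ≤ f a ∧ P a x) :=
  RecP.congr (P := fun a => ∃ x, x < f a + 1 ∧ P a x) inferInstance (by simp [lt_add_one_iff])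

/-- `Σ⁰₁` induction. -/
theorem sigma_induction {P : 𝔐.Num → 𝔐.Num → Prop}
    [h : RecP (fun p => P (fst p) (snd p))] (h0 : ∃ b, P 0 b)
    (hs : ∀ n b, P n b → ∃ b', P (n + 1) b') (n : 𝔐.Num) : ∃ b, P n b := by
  have := RCA.models.sigma_induction (.mem (.pair (.var 0) (.var 1)) 0) (params 0 0) _
    (setParams_mem h.mem_sets h.mem_sets)
  simp only [SigmaHolds] at this
  simp at this
  obtain ⟨b, hb⟩ := h0
  exact this b hb hs n

theorem rec_induction {P : 𝔐.Num → Prop} [h : RecP P] (h0 : P 0)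
    (hs : ∀ n, P n → P (n + 1)) (n : 𝔐.Num) : P n := by
  have : RecP (fun p => P (fst p)) := h.comp RecF.fst_id
  have := sigma_induction (P := fun n _ => P n) ⟨0, h0⟩ (fun n _ hn => ⟨0, hs n hn⟩) n
  exact this.elim fun _ h => h

end Comprehension
/-! ### Consequences of induction -/

theorem RecP.comp₂ {R : 𝔐.Num → 𝔐.Num → Prop} (h : RecP (fun p => R (fst p) (snd p)))
    (f g : 𝔐.Num → 𝔐.Num) [RecF f] [RecF g] : RecP (fun a => R (f a) (g a)) := by
  simpa using h.comp (f := fun a => pair (f a) (g a)) inferInstance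

theorem RecP.comp₁ {P : 𝔐.Num → Prop} (h : RecP P) (f : 𝔐.Num → 𝔐.Num) [hf : RecF f] :
    RecP (fun a => P (f a)) := h.comp hf

theorem RecF.comp₁ {g : 𝔐.Num → 𝔐.Num} (h : RecF g) (f : 𝔐.Num → 𝔐.Num) [hf : RecF f] :
    RecF (fun a => g (f a)) := h.comp hf

theorem rec_strong_induction {P : 𝔐.Num → Prop} [h : RecP P]
    (hs : ∀ n, (∀ m, m < n → P m) → P n) (n : 𝔐.Num) : P n := by
  have : RecP (fun p => P (snd p)) := h.comp RecF.snd_id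
  refine hs n ?_
  refine rec_induction (P := fun n => ∀ m, m < n → P m) (fun m hm => absurd hm not_lt_zero) ?_ n
  intro n hn m hm
  rcases (lt_add_one_iff.1 hm).lt_or_eq with h | rfl
  exacts [hn m h, hs m hn]

/-- The least number principle. -/
theorem exists_least {P : 𝔐.Num → Prop} [h : RecP P] (hP : ∃ n, P n) :
    ∃ n, P n ∧ ∀ m, m < n → ¬ P m := by
  by_contra! hn
  obtain ⟨n, hPn⟩ := hP
  exact rec_strong_induction (P := fun n => ¬ P n)
    (fun n ih hPn => by obtain ⟨m, hm, hPm⟩ := hn n hPn; exact ih m hm hPm) n hPn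

/-- `Σ⁰₁` bounding. -/
theorem exists_bound {R : 𝔐.Num → 𝔐.Num → Prop} [h : RecP (fun p => R (fst p) (snd p))]
    (l : 𝔐.Num) (hR : ∀ i, i < l → ∃ b, R i b) : ∃ B, ∀ i, i < l → ∃ b, b < B ∧ R i b := by
  -- Closure of the hypothesis under substitution is put into the local context for instance search.
  -- The same device recurs below.
  have hc := @RecP.comp₂ _ _ _ h
  obtain ⟨B, hB⟩ := sigma_induction
    (P := fun n B => n ≤ l → ∀ i, i < n → ∃ b, b < B ∧ R i b)
    ⟨0, fun _ i hi => absurd hi not_lt_zero⟩ (fun n B hB => by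
      by_cases hn : n < l
      · obtain ⟨b, hb⟩ := hR n hn
        refine ⟨B + (b + 1), fun _ i hi => ?_⟩
        rcases (lt_add_one_iff.1 hi).lt_or_eq with hi | rfl
        · obtain ⟨b', hb', hr⟩ := hB hn.le i hi
          exact ⟨b', hb'.trans_le le_self_add, hr⟩
        · exact ⟨b, (lt_add_one_iff.2 le_rfl).trans_le le_add_self, hb⟩
      · exact ⟨0, fun hn' => absurd (succ_le_iff.1 hn') hn⟩) l
  exact ⟨B, hB le_rfl⟩

open Classical in
/-- The least `b` with `Q a b`. -/
noncomputable def mu (Q : 𝔐.Num → 𝔐.Num → Prop) (a : 𝔐.Num) : 𝔐.Num :=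
  if h : ∃ b, Q a b ∧ ∀ b', b' < b → ¬ Q a b' then h.choose else 0

theorem mu_spec {Q : 𝔐.Num → 𝔐.Num → Prop} [h : RecP (fun p => Q (fst p) (snd p))]
    {a : 𝔐.Num} (ha : ∃ b, Q a b) : Q a (mu Q a) ∧ ∀ b', b' < mu Q a → ¬ Q a b' := by
  have : RecP (Q a) := h.comp₂ (fun _ => a) (fun b => b)
  have h : ∃ b, Q a b ∧ ∀ b', b' < b → ¬ Q a b' := exists_least ha
  rw [mu, dif_pos h]
  exact h.choose_spec

theorem RecF.mu {Q : 𝔐.Num → 𝔐.Num → Prop} [h : RecP (fun p => Q (L2Structure.fst p)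
    (L2Structure.snd p))] (ha : ∀ a, ∃ b, Q a b) : RecF (mu Q) := by
  have hc := @RecP.comp₂ _ _ _ h
  refine RecF.of_graph (RecP.congr (P := fun p => Q (L2Structure.fst p) (L2Structure.snd p) ∧
    ∀ b, b < L2Structure.snd p → ¬ Q (L2Structure.fst p) b) inferInstance fun p => ?_)
  obtain ⟨h1, h2⟩ := mu_spec (ha (L2Structure.fst p))
  constructor
  · rintro ⟨h3, h4⟩
    rcases lt_trichotomy (L2Structure.mu Q (L2Structure.fst p)) (L2Structure.snd p) with h | h | h
    exacts [absurd h1 (h4 _ h), h, absurd h3 (h2 _ h)]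
  · rintro h
    rw [← h]
    exact ⟨h1, h2⟩

/-! ### Divisibility -/

theorem pos_of_ne_zero {a : 𝔐.Num} (h : a ≠ 0) : 0 < a := pos_iff_ne_zero.2 h

theorem le_mul_left' {a b : 𝔐.Num} (h : a ≠ 0) : b ≤ a * b := by
  obtain rfl | ⟨c, rfl⟩ := eq_zero_or_eq_succ a
  · exact absurd rfl h
  · rw [add_mul, one_mul]; exact le_add_self

theorem le_of_dvd {a b : 𝔐.Num} (hb : b ≠ 0) (h : a ∣ b) : a ≤ b := by
  obtain ⟨c, rfl⟩ := h
  rw [mul_comm]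
  exact le_mul_left' (by rintro rfl; simp at hb)

theorem dvd_iff_bdd {a b : 𝔐.Num} : a ∣ b ↔ ∃ q ≤ b, b = a * q := by
  constructor
  · rintro ⟨q, rfl⟩
    rcases eq_or_ne a 0 with rfl | h
    exacts [⟨0, zero_le, by simp⟩, ⟨q, le_mul_left' h, rfl⟩]
  · rintro ⟨q, -, rfl⟩
    exact Dvd.intro _ rfl

instance RecP.dvd {f g : 𝔐.Num → 𝔐.Num} [RecF f] [RecF g] : RecP (fun a => f a ∣ g a) :=
  RecP.comp₂ (R := fun a b => a ∣ b) (by simp only [dvd_iff_bdd]; infer_instance) f g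

/-- Subtraction is not available, so the two quotients are compared instead. -/
theorem dvd_of_dvd_add {a x y : 𝔐.Num} (h : a ∣ x + y) (h' : a ∣ x) : a ∣ y := by
  obtain ⟨q, rfl⟩ := h'
  obtain ⟨r, hr⟩ := h
  rcases le_or_gt r q with hrq | hrq
  · have : a * q + y ≤ a * q + 0 := by rw [hr, add_zero]; gcongr
    rw [nonpos_iff_eq_zero.1 (le_of_add_le_add_left this)]
    exact dvd_zero a
  · obtain ⟨d, rfl⟩ := lt_iff_exists_add_succ.1 hrq
    rw [mul_add] at hr
    exact ⟨_, add_left_cancel hr⟩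

/-- The `i`-th modulus of the coding of finite sets. -/
def beta (m i : 𝔐.Num) : 𝔐.Num := m * (i + 1) + 1

instance RecF.beta {f g : 𝔐.Num → 𝔐.Num} [RecF f] [RecF g] :
    RecF (fun a => beta (f a) (g a)) := by unfold L2Structure.beta; infer_instance

/-- The modulus is 1 modulo `m`: `x * beta m i = m * x * (i + 1) + x`. -/
theorem dvd_of_beta_dvd_mul {m i x : 𝔐.Num} (h : beta m i ∣ m * x) : beta m i ∣ x := by
  have : beta m i ∣ m * x * (i + 1) + x := ⟨x, by rw [beta]; ring⟩
  exact dvd_of_dvd_add this (h.mul_right _)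

/-- Gödel's argument, without gcds. The two moduli differ by `m * (d + 1)`, where `d + 1` is the
distance of the indices, so `beta m i` divides `m * ((d + 1) * n)` and, after cancelling `m`, also
`(d + 1) * n`. As `d + 1` divides `m`, it divides `m * n`, hence `n`. -/
theorem beta_coprime {k m i j n : 𝔐.Num} (hm : ∀ e, e < k → e + 1 ∣ m) (hi : i < k) (hj : j < k)
    (hij : i ≠ j) (h : beta m i ∣ beta m j * n) : beta m i ∣ n := by
  have key : ∀ d, d < k → beta m i ∣ m * ((d + 1) * n) → beta m i ∣ n := by
    intro d hd h
    obtain ⟨q, hq⟩ := hm d hd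
    apply dvd_of_beta_dvd_mul
    have : m * n = (d + 1) * n * q := by rw [hq]; ring
    rw [this]
    exact (dvd_of_beta_dvd_mul h).mul_right q
  rcases lt_or_gt_of_ne hij with h' | h'
  · obtain ⟨d, rfl⟩ := lt_iff_exists_add_succ.1 h'
    refine key d (lt_of_le_of_lt (le_self_add.trans le_add_self) hj) ?_
    refine dvd_of_dvd_add (x := beta m i * n) ?_ (dvd_mul_right _ _)
    convert h using 1
    rw [beta, beta]; ring
  · obtain ⟨d, rfl⟩ := lt_iff_exists_add_succ.1 h'
    refine key d (lt_of_le_of_lt (le_self_add.trans le_add_self) hi) ?_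
    refine dvd_of_dvd_add (x := beta m j * n) ?_ h
    refine ⟨n, ?_⟩
    rw [beta, beta]; ring

/-- Iterated products are not yet available as a function; the multiple is the witness in a `Σ⁰₁`
induction. -/
theorem exists_common_multiple {f : 𝔐.Num → 𝔐.Num} (hf : RecF f) (h0 : ∀ i, f i ≠ 0)
    (k : 𝔐.Num) : ∃ m, m ≠ 0 ∧ ∀ i, i < k → f i ∣ m := by
  have hc := @RecF.comp₁ _ _ _ hf
  refine sigma_induction (P := fun k m => m ≠ 0 ∧ ∀ i, i < k → f i ∣ m)
    ⟨1, one_ne_zero, fun i hi => absurd hi not_lt_zero⟩ ?_ k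
  rintro k m ⟨hm, h⟩
  refine ⟨f k * m, fun h => ?_, fun i hi => ?_⟩
  · have : m ≤ 0 := h ▸ le_mul_left' (h0 k)
    exact hm (nonpos_iff_eq_zero.1 this)
  · rcases (lt_add_one_iff.1 hi).lt_or_eq with hi | rfl
    exacts [(h i hi).mul_left _, dvd_mul_right _ _]

theorem not_beta_dvd_one {m i : 𝔐.Num} (hm : m ≠ 0) : ¬ beta m i ∣ 1 := by
  intro h
  have h := le_of_dvd one_ne_zero h
  rw [beta] at h
  have h : m * (i + 1) + 1 ≤ 0 + 1 := by rwa [zero_add]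
  have h : m * (i + 1) ≤ 0 := le_of_add_le_add_right h
  rw [mul_comm] at h
  exact hm (nonpos_iff_eq_zero.1 ((le_mul_left' (Arith.succ_ne_zero i)).trans h))

/-- The number `n` is built as the product of the moduli with index in `P`. The bound `N` does not
depend on `P`, which later bounds the codes of all subsets of an initial segment at once. -/
theorem exists_dvd_iff {k m N : 𝔐.Num} (hm0 : m ≠ 0) (hm : ∀ e, e < k → e + 1 ∣ m) (hN0 : N ≠ 0)
    (hN : ∀ i, i < k → beta m i ∣ N) (P : 𝔐.Num → Prop) [hP : RecP P] :
    ∃ n, n ≤ N ∧ ∀ i, i < k → (beta m i ∣ n ↔ P i) := by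
  have hc := @RecP.comp₁ _ _ _ hP
  -- The coprimality clause for the moduli not yet treated, applied to `z = N / n`, shows that
  -- multiplying by the next modulus still gives a divisor of `N`. Restricting to `z ≤ N` keeps the
  -- statement recursive.
  suffices h : ∀ j, j ≤ k → ∃ n, n ≤ N ∧ (n ∣ N ∧
      (∀ i, i < k → j ≤ i → ∀ z, z ≤ N → beta m i ∣ n * z → beta m i ∣ z) ∧
      ∀ i, i < k → (beta m i ∣ n ↔ i < j ∧ P i)) by
    obtain ⟨n, hn, -, -, h⟩ := h k le_rfl
    exact ⟨n, hn, fun i hi => by rw [h i hi]; exact and_iff_right hi⟩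
  refine rec_induction ?_ ?_
  · refine fun _ => ⟨1, by simpa using succ_le_iff.2 (pos_of_ne_zero hN0), one_dvd _, ?_, ?_⟩
    · intro i _ _ z _ h; rwa [one_mul] at h
    · intro i hi
      exact ⟨fun h => absurd h (not_beta_dvd_one hm0), fun h => absurd h.1 not_lt_zero⟩
  · intro j ih hj
    have hj := succ_le_iff.1 hj
    obtain ⟨n, hnN, hn, hcop, hiff⟩ := ih hj.le
    by_cases hPj : P j
    · obtain ⟨z, hz⟩ := hn
      have hn0 : n ≠ 0 := by rintro rfl; simp at hz; exact hN0 hz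
      have hzN : z ≤ N := hz ▸ le_mul_left' hn0
      have hjz : beta m j ∣ z := hcop j hj le_rfl z hzN (hz ▸ hN j hj)
      have hdvd : beta m j * n ∣ N := by
        rw [hz, mul_comm]; exact mul_dvd_mul_left _ hjz
      refine ⟨beta m j * n, le_of_dvd hN0 hdvd, hdvd, ?_, ?_⟩
      · intro i hi hji z hz h
        have hji := succ_le_iff.1 hji
        rw [mul_assoc] at h
        exact hcop i hi hji.le z hz (beta_coprime hm hi hj hji.ne' h)
      · intro i hi
        rcases eq_or_ne i j with rfl | hij
        · exact iff_of_true (dvd_mul_right _ _) ⟨lt_add_one_iff.2 le_rfl, hPj⟩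
        · rw [lt_add_one_iff, le_iff_lt_or_eq, or_iff_left hij, ← hiff i hi]
          exact ⟨beta_coprime hm hi hj hij, fun h => h.mul_left _⟩
    · refine ⟨n, hnN, hn, fun i hi hji => hcop i hi ((succ_le_iff.1 hji).le), fun i hi => ?_⟩
      rw [hiff i hi, lt_add_one_iff, le_iff_lt_or_eq]
      constructor
      · exact fun h => ⟨.inl h.1, h.2⟩
      · rintro ⟨h | rfl, h'⟩
        exacts [⟨h, h'⟩, absurd h' hPj]

/-! ### Finite sets -/

theorem fmem_pair {i k m n : 𝔐.Num} : FMem i (pair k (pair m n)) ↔ i < k ∧ beta m i ∣ n := by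
  constructor
  · rintro ⟨k', m', n', h, hi, q, hq⟩
    simp only [pair_inj] at h
    obtain ⟨rfl, rfl, rfl⟩ := h
    exact ⟨hi, q, hq⟩
  · rintro ⟨hi, q, hq⟩
    exact ⟨k, m, n, rfl, hi, q, hq⟩

theorem FMem.lt {i c : 𝔐.Num} (h : FMem i c) : i < c := by
  obtain ⟨k, m, n, rfl, hi, -⟩ := h
  exact hi.trans_le (left_le_pair _ _)

theorem fmem_iff_bdd {i c : 𝔐.Num} : FMem i c ↔ ∃ k ≤ c, ∃ m ≤ c, ∃ n ≤ c,
    c = pair k (pair m n) ∧ i < k ∧ beta m i ∣ n := by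
  constructor
  · rintro ⟨k, m, n, rfl, hi, q, hq⟩
    exact ⟨k, left_le_pair _ _, m, (left_le_pair _ _).trans (right_le_pair _ _), n,
      (right_le_pair _ _).trans (right_le_pair _ _), rfl, hi, q, hq⟩
  · rintro ⟨k, -, m, -, n, -, rfl, h⟩
    exact fmem_pair.2 h

instance RecP.fmem {f g : 𝔐.Num → 𝔐.Num} [RecF f] [RecF g] : RecP (fun a => FMem (f a) (g a)) :=
  RecP.comp₂ (R := FMem) (by simp only [fmem_iff_bdd]; infer_instance) f g

theorem isFinset_iff_bdd {c : 𝔐.Num} :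
    IsFinset c ↔ ∀ c', c' < c → ∃ i, i < c ∧ ¬ (FMem i c' ↔ FMem i c) := by
  refine forall₂_congr fun c' hc' => ⟨fun ⟨i, hi⟩ => ⟨i, ?_, hi⟩, fun ⟨i, _, hi⟩ => ⟨i, hi⟩⟩
  by_contra h
  exact hi (iff_of_false (fun h' => h (h'.lt.trans hc')) (fun h' => h h'.lt))

instance RecP.isFinset {f : 𝔐.Num → 𝔐.Num} [RecF f] : RecP (fun a => IsFinset (f a)) :=
  RecP.comp₁ (P := IsFinset) (by
    refine RecP.congr (P := fun c => ∀ c', c' < c → ∃ i, i < c ∧ ¬ (FMem i c' ↔ FMem i c))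
      inferInstance fun c => isFinset_iff_bdd.symm) f

theorem IsFinset.ext {c d : 𝔐.Num} (hc : IsFinset c) (hd : IsFinset d)
    (h : ∀ i, FMem i c ↔ FMem i d) : c = d := by
  rcases lt_trichotomy c d with h' | h' | h'
  · obtain ⟨i, hi⟩ := hd c h'
    exact absurd (h i) hi
  · exact h'
  · obtain ⟨i, hi⟩ := hc d h'
    exact absurd (h i).symm hi

/-- `B` is larger than some code of every finite set of numbers below `k`. -/
def IsCodeBound (k B : 𝔐.Num) : Prop :=
  ∃ m, m < B ∧ ∃ N, N < B ∧ (B = pair k (pair m N) + 1 ∧ m ≠ 0 ∧ N ≠ 0 ∧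
    (∀ i, i < k → i + 1 ∣ m) ∧ ∀ i, i < k → beta m i ∣ N)

theorem exists_isCodeBound (k : 𝔐.Num) : ∃ B, IsCodeBound k B := by
  obtain ⟨m, hm0, hm⟩ := exists_common_multiple (f := fun i => i + 1) inferInstance
    Arith.succ_ne_zero k
  obtain ⟨N, hN0, hN⟩ := exists_common_multiple (f := fun i => m * (i + 1) + 1) inferInstance
    (fun i => Arith.succ_ne_zero _) k
  exact ⟨_, m, lt_add_one_iff.2 ((left_le_pair _ _).trans (right_le_pair _ _)), N,
    lt_add_one_iff.2 ((right_le_pair _ _).trans (right_le_pair _ _)), rfl, hm0, hN0, hm, hN⟩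

instance RecP.isCodeBound {f g : 𝔐.Num → 𝔐.Num} [RecF f] [RecF g] :
    RecP (fun a => IsCodeBound (f a) (g a)) :=
  RecP.comp₂ (R := IsCodeBound) (by unfold IsCodeBound; infer_instance) f g

/-- A bound for the codes of finite sets of numbers below `k`. -/
noncomputable def codeBound (k : 𝔐.Num) : 𝔐.Num := mu IsCodeBound k

theorem isCodeBound_codeBound (k : 𝔐.Num) : IsCodeBound k (codeBound k) :=
  (mu_spec (exists_isCodeBound k)).1

instance RecF.codeBound {f : 𝔐.Num → 𝔐.Num} [hf : RecF f] : RecF (fun a => codeBound (f a)) :=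
  (RecF.mu exists_isCodeBound).comp hf

theorem exists_code_lt (k : 𝔐.Num) (P : 𝔐.Num → Prop) [RecP P] :
    ∃ c, c < codeBound k ∧ ∀ i, FMem i c ↔ i < k ∧ P i := by
  obtain ⟨m, -, N, -, hB, hm0, hN0, hm, hN⟩ := isCodeBound_codeBound k
  obtain ⟨n, hn, h⟩ := exists_dvd_iff hm0 hm hN0 hN P
  refine ⟨pair k (pair m n), ?_, fun i => ?_⟩
  · rw [hB, lt_add_one_iff]
    exact pair_le_pair le_rfl (pair_le_pair le_rfl hn)
  · rw [fmem_pair]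
    exact and_congr_right fun hi => h i hi

theorem exists_finset (k : 𝔐.Num) (P : 𝔐.Num → Prop) [hP : RecP P] :
    ∃ c, IsFinset c ∧ ∀ i, FMem i c ↔ i < k ∧ P i := by
  have hc := @RecP.comp₁ _ _ _ hP
  obtain ⟨c₀, -, h₀⟩ := exists_code_lt k P
  -- Elements of `c` lie below `c` and those of the target set below `k`, so the test up to `c + k`
  -- is complete.
  obtain ⟨c, hc, hmin⟩ := exists_least (P := fun c => ∀ i, i < c + k → (FMem i c ↔ i < k ∧ P i))
    ⟨c₀, fun i _ => h₀ i⟩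
  have hc : ∀ i, FMem i c ↔ i < k ∧ P i := by
    intro i
    by_cases hi : i < c + k
    · exact hc i hi
    · exact iff_of_false (fun h => hi (h.lt.trans_le le_self_add))
        (fun h => hi (h.1.trans_le le_add_self))
  refine ⟨c, fun c' hc' => ?_, hc⟩
  by_contra! h
  exact hmin c' hc' fun i _ => (h i).trans (hc i)

/-- A canonical code is at most any other code of the same set, and some code is below `codeBound
k`. -/
theorem IsFinset.lt_codeBound {c k : 𝔐.Num} (hc : IsFinset c) (h : ∀ i, FMem i c → i < k) :
    c < codeBound k := by
  obtain ⟨d, hd, h'⟩ := exists_code_lt k (fun i => FMem i c)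
  refine lt_of_not_ge fun hle => ?_
  obtain ⟨i, hi⟩ := hc d (hd.trans_le hle)
  exact hi ((h' i).trans ⟨fun h => h.2, fun hi => ⟨h i hi, hi⟩⟩)

open Classical in
/-- The code of the finite set `{x < k : P x}`. -/
noncomputable def mkSet (k : 𝔐.Num) (P : 𝔐.Num → Prop) : 𝔐.Num :=
  if h : ∃ c, IsFinset c ∧ ∀ i, FMem i c ↔ i < k ∧ P i then h.choose else 0

theorem isFinset_mkSet (k : 𝔐.Num) (P : 𝔐.Num → Prop) [RecP P] : IsFinset (mkSet k P) := by
  rw [mkSet, dif_pos (exists_finset k P)]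
  exact (exists_finset k P).choose_spec.1

theorem fmem_mkSet {k : 𝔐.Num} {P : 𝔐.Num → Prop} [RecP P] {i : 𝔐.Num} :
    FMem i (mkSet k P) ↔ i < k ∧ P i := by
  rw [mkSet, dif_pos (exists_finset k P)]
  exact (exists_finset k P).choose_spec.2 i

instance RecF.mkSet {f : 𝔐.Num → 𝔐.Num} {P : 𝔐.Num → 𝔐.Num → Prop} [RecF f]
    [h : RecP (fun p => P (L2Structure.fst p) (L2Structure.snd p))] :
    RecF (fun a => mkSet (f a) (P a)) := by
  have hc := @RecP.comp₂ _ _ _ h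
  have hP : ∀ a, RecP (P a) := fun a => h.comp₂ (fun _ => a) (fun b => b)
  have hcomp : RecF fun p => f (L2Structure.fst p) := RecF.comp ‹_› RecF.fst_id
  refine RecF.of_graph (RecP.congr (P := fun p => IsFinset (L2Structure.snd p) ∧
    ∀ i, i < L2Structure.snd p + f (L2Structure.fst p) → (FMem i (L2Structure.snd p) ↔
      i < f (L2Structure.fst p) ∧ P (L2Structure.fst p) i)) ?_ fun p => ?_)
  · have : RecF fun p => f (L2Structure.fst (L2Structure.fst p)) := hcomp.comp RecF.fst_id
    infer_instance
  constructor
  · rintro ⟨h1, h2⟩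
    refine (isFinset_mkSet _ _).ext h1 fun i => ?_
    rw [fmem_mkSet]
    by_cases hi : i < L2Structure.snd p + f (L2Structure.fst p)
    · exact (h2 i hi).symm
    · exact iff_of_false (fun h => hi (h.1.trans_le le_add_self))
        (fun h => hi (h.lt.trans_le le_self_add))
  · rintro h
    rw [← h]
    exact ⟨isFinset_mkSet _ _, fun i _ => fmem_mkSet⟩

/-! ### Sequences and strings -/

theorem zero_ne_one' : (0 : 𝔐.Num) ≠ 1 := zero_ne_one

theorem Entry.index_lt {s i x : 𝔐.Num} (h : Entry s i x) : i < s :=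
  (left_le_pair i x).trans_lt (FMem.lt h)

theorem Entry.value_lt {s i x : 𝔐.Num} (h : Entry s i x) : x < s :=
  (right_le_pair i x).trans_lt (FMem.lt h)

instance RecP.entry {f g h : 𝔐.Num → 𝔐.Num} [RecF f] [RecF g] [RecF h] :
    RecP (fun a => Entry (f a) (g a) (h a)) := by unfold Entry; infer_instance

section Seq

variable {s t l m i x y : 𝔐.Num}

theorem IsSeq.index_lt (hs : IsSeq s l) (h : Entry s i x) : i < l := by
  obtain ⟨i', x', hi, e⟩ := hs.2.1 _ h
  rwa [(pair_inj.1 e).1]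

theorem IsSeq.unique (hs : IsSeq s l) (h : Entry s i x) (h' : Entry s i y) : x = y :=
  (hs.2.2 i (hs.index_lt h)).unique h h'

omit [RCA 𝔐] in
theorem IsSeq.exists (hs : IsSeq s l) (h : i < l) : ∃ x, Entry s i x := (hs.2.2 i h).exists

theorem IsSeq.ext (hs : IsSeq s l) (ht : IsSeq t l)
    (h : ∀ i, i < l → ∀ x, Entry s i x → Entry t i x) : s = t := by
  refine hs.1.ext ht.1 fun p => ⟨fun hp => ?_, fun hp => ?_⟩
  · obtain ⟨i, x, hi, rfl⟩ := hs.2.1 p hp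
    exact h i hi x hp
  · obtain ⟨i, x, hi, rfl⟩ := ht.2.1 p hp
    obtain ⟨y, hy⟩ := hs.exists hi
    rwa [ht.unique hp (h i hi y hy)]

theorem IsSeq.length_le (hs : IsSeq s l) : l ≤ s := by
  obtain rfl | ⟨k, rfl⟩ := eq_zero_or_eq_succ l
  · exact zero_le
  · obtain ⟨x, hx⟩ := hs.exists (lt_add_one_iff.2 le_rfl)
    exact succ_le_iff.2 hx.index_lt

theorem IsSeq.length_unique (hs : IsSeq s l) (ht : IsSeq s m) : l = m := by
  rcases lt_trichotomy l m with h | h | h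
  · obtain ⟨x, hx⟩ := ht.exists h
    exact absurd (hs.index_lt hx) (lt_irrefl _)
  · exact h
  · obtain ⟨x, hx⟩ := hs.exists h
    exact absurd (ht.index_lt hx) (lt_irrefl _)

theorem isSeq_iff_bdd : IsSeq s l ↔ IsFinset s ∧
    (∀ p, p < s → FMem p s → ∃ i, i < l ∧ ∃ x, x < s ∧ p = pair i x) ∧
    ∀ i, i < l → ∃ x, x < s ∧ (Entry s i x ∧ ∀ y, y < s → Entry s i y → y = x) := by
  refine and_congr_right fun _ => and_congr ?_ ?_
  · constructor
    · intro h p _ hp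
      obtain ⟨i, x, hi, rfl⟩ := h p hp
      exact ⟨i, hi, x, Entry.value_lt hp, rfl⟩
    · intro h p hp
      obtain ⟨i, hi, x, -, e⟩ := h p hp.lt hp
      exact ⟨i, x, hi, e⟩
  · refine forall₂_congr fun i _ => ?_
    constructor
    · rintro ⟨x, hx, h⟩
      exact ⟨x, hx.value_lt, hx, fun y _ => h y⟩
    · rintro ⟨x, -, hx, h⟩
      exact ⟨x, hx, fun y hy => h y hy.value_lt hy⟩

instance RecP.isSeq {f g : 𝔐.Num → 𝔐.Num} [RecF f] [RecF g] : RecP (fun a => IsSeq (f a) (g a)) :=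
  RecP.comp₂ (R := IsSeq) (by simp only [isSeq_iff_bdd]; infer_instance) f g

theorem isString_iff_bdd : IsString s l ↔ IsSeq s l ∧
    ∀ i, i < s → ∀ x, x < s → Entry s i x → x = 0 ∨ x = 1 :=
  and_congr_right fun _ => ⟨fun h i _ x _ => h i x, fun h i x hx => h i hx.index_lt x hx.value_lt hx⟩

instance RecP.isString {f g : 𝔐.Num → 𝔐.Num} [RecF f] [RecF g] :
    RecP (fun a => IsString (f a) (g a)) :=
  RecP.comp₂ (R := IsString) (by simp only [isString_iff_bdd]; infer_instance) f g

theorem IsString.zero_iff (hs : IsString s l) (hi : i < l) : Entry s i 0 ↔ ¬ Entry s i 1 := by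
  constructor
  · exact fun h h' => zero_ne_one' (hs.1.unique h h')
  · intro h
    obtain ⟨x, hx⟩ := hs.1.exists hi
    rcases hs.2 i x hx with rfl | rfl
    exacts [hx, absurd hx h]

theorem IsString.ext (hs : IsString s l) (ht : IsString t l)
    (h : ∀ i, i < l → (Entry s i 1 ↔ Entry t i 1)) : s = t := by
  refine hs.1.ext ht.1 fun i hi x hx => ?_
  rcases hs.2 i x hx with rfl | rfl
  · rwa [ht.zero_iff hi, ← h i hi, ← hs.zero_iff hi]
  · rwa [← h i hi]

/-- Makes quantification over binary strings of length `l` a bounded, hence recursive, operation. -/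
theorem IsString.lt_codeBound (hs : IsString s l) : s < codeBound (pair l 1) := by
  refine hs.1.1.lt_codeBound fun p hp => ?_
  obtain ⟨i, x, hi, rfl⟩ := hs.1.2.1 p hp
  rcases hs.2 i x hp with rfl | rfl
  exacts [pair_lt_pair hi zero_le, pair_lt_pair hi le_rfl]

theorem isInit_iff (hs : IsString s l) (ht : IsString t m) (hm : m ≤ l) :
    IsInit t m s ↔ ∀ i, i < m → (Entry t i 1 ↔ Entry s i 1) := by
  refine ⟨fun h i hi => h.2 i hi 1, fun h => ⟨ht.1, fun i hi x => ⟨fun hx => ?_, fun hx => ?_⟩⟩⟩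
  · rcases ht.2 i x hx with rfl | rfl
    · rwa [hs.zero_iff (hi.trans_le hm), ← h i hi, ← ht.zero_iff hi]
    · rwa [← h i hi]
  · rcases hs.2 i x hx with rfl | rfl
    · rwa [ht.zero_iff hi, h i hi, ← hs.zero_iff (hi.trans_le hm)]
    · rwa [h i hi]

theorem IsInit.isString (h : IsInit t m s) (hs : IsString s l) : IsString t m :=
  ⟨h.1, fun i x hx => hs.2 i x ((h.2 i (h.1.index_lt hx) x).1 hx)⟩

/-- The binary string of length `l` with `1` exactly at the places in `P`. -/
noncomputable def mkString (l : 𝔐.Num) (P : 𝔐.Num → Prop) : 𝔐.Num :=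
  mkSet (pair l 1) fun p => ∃ i, i < l ∧ ((P i ∧ p = pair i 1) ∨ (¬ P i ∧ p = pair i 0))

theorem entry_mkString {P : 𝔐.Num → Prop} [hP : RecP P] :
    Entry (mkString l P) i x ↔ i < l ∧ ((P i ∧ x = 1) ∨ (¬ P i ∧ x = 0)) := by
  have hc := @RecP.comp₁ _ _ _ hP
  rw [Entry, mkString, fmem_mkSet]
  constructor
  · rintro ⟨-, i', hi, h⟩
    simp only [pair_inj] at h
    rcases h with ⟨h1, rfl, rfl⟩ | ⟨h1, rfl, rfl⟩
    exacts [⟨hi, .inl ⟨h1, rfl⟩⟩, ⟨hi, .inr ⟨h1, rfl⟩⟩]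
  · rintro ⟨hi, ⟨h, rfl⟩ | ⟨h, rfl⟩⟩
    exacts [⟨pair_lt_pair hi le_rfl, i, hi, .inl ⟨h, rfl⟩⟩,
      ⟨pair_lt_pair hi zero_le, i, hi, .inr ⟨h, rfl⟩⟩]

theorem entry_mkString_one {P : 𝔐.Num → Prop} [hP : RecP P] (hi : i < l) :
    Entry (mkString l P) i 1 ↔ P i := by
  rw [entry_mkString]
  simp [hi]

theorem isString_mkString (l : 𝔐.Num) (P : 𝔐.Num → Prop) [hP : RecP P] :
    IsString (mkString l P) l := by
  have hc := @RecP.comp₁ _ _ _ hP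
  refine ⟨⟨isFinset_mkSet _ _, fun p hp => ?_, fun i hi => ?_⟩, fun i x h => ?_⟩
  · obtain ⟨-, i, hi, ⟨-, h⟩ | ⟨-, h⟩⟩ := fmem_mkSet.1 hp
    exacts [⟨i, 1, hi, h⟩, ⟨i, 0, hi, h⟩]
  · by_cases h : P i
    · exact ⟨1, entry_mkString.2 ⟨hi, .inl ⟨h, rfl⟩⟩, fun y hy => by
        simpa [h] using (entry_mkString.1 hy).2⟩
    · exact ⟨0, entry_mkString.2 ⟨hi, .inr ⟨h, rfl⟩⟩, fun y hy => by
        simpa [h] using (entry_mkString.1 hy).2⟩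
  · obtain ⟨-, ⟨-, h⟩ | ⟨-, h⟩⟩ := entry_mkString.1 h
    exacts [.inr h, .inl h]

theorem RecF.mkString {f : 𝔐.Num → 𝔐.Num} {P : 𝔐.Num → 𝔐.Num → Prop} [hf : RecF f]
    [h : RecP (fun p => P (L2Structure.fst p) (L2Structure.snd p))] :
    RecF (fun a => mkString (f a) (P a)) := by
  have hc := @RecP.comp₂ _ _ _ h
  have hf' := @RecF.comp₁ _ _ _ hf
  unfold L2Structure.mkString
  infer_instance

end Seq

/-! ### Relations and satisfaction -/

theorem IsRel.arity_unique {c n m : 𝔐.Num} (h : IsRel c n) (h' : IsRel c m) : n = m := by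
  obtain ⟨a, rfl, -⟩ := h
  obtain ⟨b, h, -⟩ := h'
  exact (pair_inj.1 h).1

theorem IsRel.isString {c n r : 𝔐.Num} (h : IsRel c n) (hr : RelMem r c) : IsString r n := by
  obtain ⟨a, rfl, -, -, h⟩ := h
  obtain ⟨n', a', h', hr⟩ := hr
  obtain ⟨rfl, rfl⟩ := pair_inj.1 h'
  exact h r hr

omit [RCA 𝔐] in
theorem IsRel.exists_mem {c n : 𝔐.Num} (h : IsRel c n) : ∃ r, RelMem r c := by
  obtain ⟨a, rfl, -, ⟨r, hr⟩, -⟩ := h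
  exact ⟨r, n, a, rfl, hr⟩

theorem IsRel.le {c n : 𝔐.Num} (h : IsRel c n) : n ≤ c := by
  obtain ⟨a, rfl, -⟩ := h
  exact left_le_pair _ _

theorem RelMem.lt {r c : 𝔐.Num} (h : RelMem r c) : r < c := by
  obtain ⟨n, a, rfl, hr⟩ := h
  exact hr.lt.trans_le (right_le_pair _ _)

theorem isRel_iff_bdd {c n : 𝔐.Num} : IsRel c n ↔ ∃ a, a ≤ c ∧ (c = pair n a ∧ IsFinset a ∧
    (∃ r, r < a ∧ FMem r a) ∧ ∀ r, r < a → FMem r a → IsString r n) := by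
  constructor
  · rintro ⟨a, rfl, h, ⟨r, hr⟩, h'⟩
    exact ⟨a, right_le_pair _ _, rfl, h, ⟨r, hr.lt, hr⟩, fun r _ => h' r⟩
  · rintro ⟨a, -, rfl, h, ⟨r, -, hr⟩, h'⟩
    exact ⟨a, rfl, h, ⟨r, hr⟩, fun r hr => h' r hr.lt hr⟩

instance RecP.isRel {f g : 𝔐.Num → 𝔐.Num} [RecF f] [RecF g] : RecP (fun a => IsRel (f a) (g a)) :=
  RecP.comp₂ (R := IsRel) (by simp only [isRel_iff_bdd]; infer_instance) f g

theorem relMem_iff_bdd {r c : 𝔐.Num} :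
    RelMem r c ↔ ∃ n, n ≤ c ∧ ∃ a, a ≤ c ∧ (c = pair n a ∧ FMem r a) := by
  constructor
  · rintro ⟨n, a, rfl, h⟩
    exact ⟨n, left_le_pair _ _, a, right_le_pair _ _, rfl, h⟩
  · rintro ⟨n, -, a, -, h⟩
    exact ⟨n, a, h⟩

instance RecP.relMem {f g : 𝔐.Num → 𝔐.Num} [RecF f] [RecF g] :
    RecP (fun a => RelMem (f a) (g a)) :=
  RecP.comp₂ (R := RelMem) (by simp only [relMem_iff_bdd]; infer_instance) f g

/-- The `i`-th entry of `r` is the truth value of `x` under the assignment `A`. -/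
def Agrees (A : Set 𝔐.Num) (r i x : 𝔐.Num) : Prop := (x ∈ A → Entry r i 1) ∧ (x ∉ A → Entry r i 0)

theorem agrees_iff {A : Set 𝔐.Num} {r i x l : 𝔐.Num} (hr : IsString r l) (hi : i < l) :
    Agrees A r i x ↔ (Entry r i 1 ↔ x ∈ A) := by
  rw [Agrees, hr.zero_iff hi]
  tauto

/-- A bounded form of satisfaction, with the assignment given by a predicate. -/
theorem satisfies_iff_bdd {A : Set 𝔐.Num} {φ : 𝔐.Num} : Satisfies A φ ↔
    ∃ c, c ≤ φ ∧ ∃ n, n ≤ φ ∧ ∃ y, y ≤ φ ∧ ∃ r, r ≤ φ ∧ (φ = pair c y ∧ IsRel c n ∧ IsSeq y n ∧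
      RelMem r c ∧ ∀ i, i < y → ∀ x, x < y → Entry y i x →
        (x ∈ A → Entry r i 1) ∧ (x ∉ A → Entry r i 0)) := by
  constructor
  · rintro ⟨c, n, y, r, rfl, hc, hy, hr, h⟩
    exact ⟨c, left_le_pair _ _, n, hc.le.trans (left_le_pair _ _), y, right_le_pair _ _, r,
      hr.lt.le.trans (left_le_pair _ _), rfl, hc, hy, hr, fun i _ x _ => h i x⟩
  · rintro ⟨c, -, n, -, y, -, r, -, h1, h2, h3, h4, h⟩
    exact ⟨c, n, y, r, h1, h2, h3, h4, fun i x hx => h i hx.index_lt x hx.value_lt hx⟩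

theorem satisfies_pair_iff {A : Set 𝔐.Num} {c n y : 𝔐.Num} (hc : IsRel c n) (hy : IsSeq y n) :
    Satisfies A (pair c y) ↔ ∃ r, RelMem r c ∧ ∀ i x, Entry y i x → Agrees A r i x := by
  constructor
  · rintro ⟨c', n', y', r, h, -, -, hr, h'⟩
    obtain ⟨rfl, rfl⟩ := pair_inj.1 h
    exact ⟨r, hr, h'⟩
  · rintro ⟨r, hr, h⟩
    exact ⟨c, n, y, r, rfl, hc, hy, hr, h⟩

omit [RCA 𝔐] in
theorem Satisfies.congr {A B : Set 𝔐.Num} {φ : 𝔐.Num} (h : Satisfies A φ)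
    (hAB : ∀ c y i x, φ = pair c y → Entry y i x → (x ∈ A ↔ x ∈ B)) : Satisfies B φ := by
  obtain ⟨c, n, y, r, e, hc, hy, hr, h⟩ := h
  refine ⟨c, n, y, r, e, hc, hy, hr, fun i x hx => ?_⟩
  rw [← hAB c y i x e hx]
  exact h i x hx

/-! ### `SAT(S)` from weak König's lemma -/

theorem satClass_of_wkl (h : 𝔐.WKL) (S : Set 𝔐.Num) : SATClass S := by
  intro V hV _ C hC hform hsat
  have hVr := RecP.of_mem hV
  have hCr := RecP.of_mem hC
  let T : Set 𝔐.Num := {s | ∃ l, l ≤ s ∧ (IsString s l ∧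
    ∀ φ, φ < l → φ ∈ C → Satisfies {x | Entry s x 1} φ)}
  have hT : T ∈ 𝔐.sets := by
    refine RecP.mem_sets (P := fun s => ∃ l, l ≤ s ∧ (IsString s l ∧
      ∀ φ, φ < l → φ ∈ C → Satisfies {x | Entry s x 1} φ)) (self := ?_)
    simp only [satisfies_iff_bdd, Set.mem_ofPred_eq]
    infer_instance
  have hTs : ∀ s l, IsString s l → (s ∈ T ↔
      ∀ φ, φ < l → φ ∈ C → Satisfies {x | Entry s x 1} φ) := by
    intro s l hs
    constructor
    · rintro ⟨l', -, hs', h⟩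
      rwa [hs.1.length_unique hs'.1]
    · exact fun h => ⟨l, hs.1.length_le, hs, h⟩
  -- Hence a string of length greater than `φ` decides every variable of `φ`.
  have hocc : ∀ {φ c y i x : 𝔐.Num}, φ = pair c y → Entry y i x → x < φ := by
    rintro φ c y i x rfl hx
    exact hx.value_lt.trans_le (right_le_pair _ _)
  have htree : IsBinTree T := by
    refine ⟨fun s ⟨l, _, hs, _⟩ => ⟨l, hs⟩, ?_⟩
    intro s hs l m t hsl hml hinit
    have ht := hinit.isString hsl
    have hml : m ≤ l := hml
    rw [hTs t m ht]
    intro φ hφ hφC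
    refine ((hTs s l hsl).1 hs φ (hφ.trans_le hml) hφC).congr fun c y i x e hx => ?_
    exact ((isInit_iff hsl ht hml).1 hinit x ((hocc e hx).trans hφ)).symm
  have hinf : Infinite T := by
    intro k
    obtain ⟨A, hA, -, hAF⟩ := hsat {φ | φ ∈ C ∧ φ < k} RecP.mem_sets (fun φ h => h.1)
      ⟨k, fun φ h => h.2⟩
    have hAr := RecP.of_mem hA
    have hs := isString_mkString k (fun x => x ∈ A)
    refine ⟨_, (hTs _ _ hs).2 fun φ hφ hφC => ?_, hs.1.length_le.not_gt⟩
    refine (hAF φ ⟨hφC, hφ⟩).congr fun c y i x e hx => ?_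
    exact (entry_mkString_one ((hocc e hx).trans hφ)).symm
  obtain ⟨P, hP, hpath⟩ := h T hT htree hinf
  have hPr := RecP.of_mem hP
  -- The path also decides numbers that are not variables; discarding them affects no formula over
  -- `V`.
  refine ⟨{x | x ∈ P ∧ x ∈ V}, RecP.mem_sets, fun x hx => hx.2, fun φ hφ => ?_⟩
  obtain ⟨s, hsT, hs, hsP⟩ := hpath (φ + 1)
  refine ((hTs s _ hs).1 hsT φ (lt_add_one_iff.2 le_rfl) hφ).congr fun c y i x e hx => ?_
  have hxV : x ∈ V := by
    obtain ⟨c', -, n, y', e', -, -, hV⟩ := hform φ hφ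
    obtain ⟨rfl, rfl⟩ := pair_inj.1 (e.symm.trans e')
    exact hV i x hx
  exact (hsP x ((hocc e hx).trans (lt_add_one_iff.2 le_rfl))).trans
    ⟨fun h => ⟨h, hxV⟩, fun h => h.1⟩

/-! ### The easy classes -/

theorem satClass_of_zero_valid {S : Set 𝔐.Num} (h : ∀ c ∈ S, RelValid 0 c) : SATClass S := by
  intro V hV _ C hC hform _
  refine ⟨{x | False}, RecP.mem_sets, fun x h => h.elim, fun φ hφ => ?_⟩
  obtain ⟨c, hc, n, y, rfl, hcn, hy, -⟩ := hform φ hφ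
  obtain ⟨n', r, hcn', hr, h0⟩ := h c hc
  obtain rfl := hcn.arity_unique hcn'
  exact ⟨c, n, y, r, rfl, hcn, hy, hr, fun i x hx =>
    ⟨fun h => h.elim, fun _ => h0 i (hy.index_lt hx)⟩⟩

theorem satClass_of_one_valid {S : Set 𝔐.Num} (h : ∀ c ∈ S, RelValid 1 c) : SATClass S := by
  intro V hV _ C hC hform _
  refine ⟨V, hV, subset_rfl, fun φ hφ => ?_⟩
  obtain ⟨c, hc, n, y, rfl, hcn, hy, hyV⟩ := hform φ hφ
  obtain ⟨n', r, hcn', hr, h0⟩ := h c hc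
  obtain rfl := hcn.arity_unique hcn'
  exact ⟨c, n, y, r, rfl, hcn, hy, hr, fun i x hx =>
    ⟨fun _ => h0 i (hy.index_lt hx), fun h => absurd (hyV i x hx) h⟩⟩

theorem IsString.entry_bit {s l i : 𝔐.Num} (hs : IsString s l) (hi : i < l) (b : Bool) :
    Entry s i (𝔐.bit b) ↔ (Entry s i 1 ↔ b = true) := by
  cases b
  · simp [bit, hs.zero_iff hi]
  · simp [bit]

/-- The code of the unary relation `{b}`. -/
noncomputable def literalCode (𝔐 : L2Structure.{u}) [RCA 𝔐] (b : Bool) : 𝔐.Num :=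
  pair 1 (mkSet (codeBound (pair 1 1)) fun r => IsString r 1 ∧ Entry r 0 (𝔐.bit b))

theorem exists_string_one (b : Bool) :
    ∃ r : 𝔐.Num, IsString r 1 ∧ Entry r 0 (𝔐.bit b) := by
  have hs := isString_mkString (1 : 𝔐.Num) (fun _ => b = true)
  refine ⟨_, hs, ?_⟩
  rw [hs.entry_bit zero_lt_one, entry_mkString_one zero_lt_one]

theorem relMem_literalCode {b : Bool} {r : 𝔐.Num} :
    RelMem r (𝔐.literalCode b) ↔ IsString r 1 ∧ Entry r 0 (𝔐.bit b) := by
  constructor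
  · rintro ⟨n, a, e, h⟩
    obtain ⟨rfl, rfl⟩ := pair_inj.1 e
    exact (fmem_mkSet.1 h).2
  · intro h
    exact ⟨_, _, rfl, fmem_mkSet.2 ⟨h.1.lt_codeBound, h⟩⟩

/-- Because codes are canonical, whether `C` contains the literal on a given variable is a question
about one number. -/
theorem relIsLiteral_iff {b : Bool} {c : 𝔐.Num} :
    RelIsLiteral (𝔐.bit b) c ↔ c = 𝔐.literalCode b := by
  have h0 : RelIsLiteral (𝔐.bit b) (𝔐.literalCode b) := by
    refine ⟨⟨_, rfl, isFinset_mkSet _ _, ?_, fun r hr => (fmem_mkSet.1 hr).2.1⟩,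
      fun r => relMem_literalCode⟩
    obtain ⟨r, hr⟩ := exists_string_one (𝔐 := 𝔐) b
    exact ⟨r, fmem_mkSet.2 ⟨hr.1.lt_codeBound, hr⟩⟩
  refine ⟨fun h => ?_, by rintro rfl; exact h0⟩
  obtain ⟨⟨a, rfl, ha, -⟩, h⟩ := h
  unfold literalCode
  congr 1
  refine ha.ext (isFinset_mkSet _ _) fun r => ?_
  rw [fmem_mkSet]
  have : FMem r a ↔ RelMem r (pair 1 a) :=
    ⟨fun h => ⟨1, a, rfl, h⟩, fun ⟨n, a', e, h⟩ => by rwa [(pair_inj.1 e).2]⟩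
  rw [this, h]
  exact ⟨fun h => ⟨h.1.lt_codeBound, h⟩, fun h => h.2⟩

/-- The code of the sequence `⟨x⟩`. -/
noncomputable def single (x : 𝔐.Num) : 𝔐.Num := mkSet (pair 0 x + 1) fun p => p = pair 0 x

theorem entry_single {x i z : 𝔐.Num} : Entry (single x) i z ↔ i = 0 ∧ z = x := by
  rw [Entry, single, fmem_mkSet, pair_inj]
  constructor
  · exact fun h => h.2
  · rintro ⟨rfl, rfl⟩
    exact ⟨lt_add_one_iff.2 le_rfl, rfl, rfl⟩

theorem lt_one_iff' {i : 𝔐.Num} : i < 1 ↔ i = 0 := by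
  rw [← zero_add (1 : 𝔐.Num), lt_add_one_iff, nonpos_iff_eq_zero]

theorem isSeq_single (x : 𝔐.Num) : IsSeq (single x) 1 := by
  refine ⟨isFinset_mkSet _ _, fun p hp => ⟨0, x, zero_lt_one, (fmem_mkSet.1 hp).2⟩, fun i hi => ?_⟩
  obtain rfl := lt_one_iff'.1 hi
  exact ⟨x, entry_single.2 ⟨rfl, rfl⟩, fun y hy => (entry_single.1 hy).2⟩

instance RecF.single_id : RecF (single : 𝔐.Num → 𝔐.Num) := by
  unfold L2Structure.single; infer_instance

instance RecF.single {f : 𝔐.Num → 𝔐.Num} [hf : RecF f] : RecF (fun a => single (f a)) :=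
  RecF.single_id.comp hf

theorem satisfies_literal {A : Set 𝔐.Num} {b : Bool} {x : 𝔐.Num} :
    Satisfies A (pair (𝔐.literalCode b) (single x)) ↔ (x ∈ A ↔ b = true) := by
  rw [satisfies_pair_iff (relIsLiteral_iff.2 rfl).1 (isSeq_single x)]
  simp only [relMem_literalCode, entry_single]
  constructor
  · rintro ⟨r, ⟨hr, h⟩, h'⟩
    have := (agrees_iff hr zero_lt_one).1 (h' 0 x ⟨rfl, rfl⟩)
    rw [← this, ← hr.entry_bit zero_lt_one]
    exact h
  · intro h
    obtain ⟨r, hr, h'⟩ := exists_string_one (𝔐 := 𝔐) b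
    refine ⟨r, ⟨hr, h'⟩, ?_⟩
    rintro i z ⟨rfl, rfl⟩
    rw [agrees_iff hr zero_lt_one, h, ← hr.entry_bit zero_lt_one]
    exact h'

/-- Variables get the value `!b` unless a literal in `C` demands `b`. A formula with a default
relation is satisfied together with the literals on its variables by some assignment `A'`; moving
from `A'` to `A` changes entries only to `!b`, which the relation tolerates. -/
theorem satClass_of_default {S : Set 𝔐.Num} {b : Bool}
    (h : ∀ c ∈ S, ¬ RelDefault (𝔐.bit !b) c → RelIsLiteral (𝔐.bit b) c) : SATClass S := by
  intro V hV _ C hC hform hsat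
  have hVr := RecP.of_mem hV
  have hCr := RecP.of_mem hC
  set unit : 𝔐.Num → 𝔐.Num := fun x => pair (𝔐.literalCode b) (single x) with hunit
  let A : Set 𝔐.Num := {x | x ∈ V ∧ (pair (𝔐.literalCode b) (single x) ∈ C ↔ b = true)}
  have hA : A ∈ 𝔐.sets := RecP.mem_sets
  have hAr := RecP.of_mem hA
  refine ⟨A, hA, fun x hx => hx.1, fun φ hφ => ?_⟩
  obtain ⟨c, hc, n, y, e, hcn, hy, hyV⟩ := hform φ hφ
  have hAy : ∀ i x, Entry y i x → (x ∈ A ↔ (unit x ∈ C ↔ b = true)) :=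
    fun i x hx => and_iff_right (hyV i x hx)
  by_cases hd : RelDefault (𝔐.bit !b) c
  · obtain ⟨B, hB⟩ := exists_bound (R := fun x v => v = pair (𝔐.literalCode b) (single x)) φ
      (fun x _ => ⟨_, rfl⟩)
    obtain ⟨A', hA', -, hF⟩ := hsat {ψ | ψ ∈ C ∧ ψ < φ + 1 + B} RecP.mem_sets (fun φ h => h.1)
      ⟨φ + 1 + B, fun φ h => h.2⟩
    have hA'r := RecP.of_mem hA'
    have hφ' := hF φ ⟨hφ, (lt_add_one_iff.2 le_rfl).trans_le le_self_add⟩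
    have hunit' : ∀ i x, Entry y i x → unit x ∈ C → (x ∈ A' ↔ b = true) := by
      intro i x hx hxC
      have hxφ : x < φ := hx.value_lt.trans_le (e ▸ right_le_pair _ _)
      obtain ⟨v, hv, rfl⟩ := hB x hxφ
      exact satisfies_literal.1 (hF _ ⟨hxC, hv.trans_le le_add_self⟩)
    rw [e, satisfies_pair_iff hcn hy] at hφ'
    obtain ⟨r₀, hr₀, hr₀A⟩ := hφ'
    obtain ⟨n', hcn', hd⟩ := hd
    obtain rfl := hcn.arity_unique hcn'
    -- A hybrid vector: places below `k` are evaluated by `A`, the others by `A'`. The bounds on `r`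
    -- and `x` keep the induction recursive.
    have key : ∀ k, k ≤ n → ∃ r, r < c ∧ (RelMem r c ∧ ∀ i, i < n → ∀ x, x < y → Entry y i x →
        ((i < k → (Entry r i 1 ↔ x ∈ A)) ∧ (k ≤ i → (Entry r i 1 ↔ x ∈ A')))) := by
      refine rec_induction ?_ ?_
      · refine fun _ => ⟨r₀, hr₀.lt, hr₀, fun i hi x _ hx => ⟨fun h => absurd h not_lt_zero, fun _ =>
          (agrees_iff (hcn.isString hr₀) hi).1 (hr₀A i x hx)⟩⟩
      · intro k ih hk
        have hk := succ_le_iff.1 hk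
        obtain ⟨r, -, hr, hrA⟩ := ih hk.le
        obtain ⟨x₀, hx₀⟩ := hy.exists hk
        -- If the literal is in `C`, both assignments give `x₀` the value `b` and nothing changes;
        -- otherwise `A` gives `!b` and the default property supplies the new vector.
        by_cases hxC : unit x₀ ∈ C
        · refine ⟨r, hr.lt, hr, fun i hi x hxy hx => ⟨fun hik => ?_, fun hik =>
            (hrA i hi x hxy hx).2 (succ_le_iff.1 hik).le⟩⟩
          rcases (lt_add_one_iff.1 hik).lt_or_eq with hik | rfl
          · exact (hrA i hi x hxy hx).1 hik
          · obtain rfl := hy.unique hx hx₀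
            rw [(hrA i hi x hxy hx).2 le_rfl, hAy i x hx, hunit' i x hx hxC]
            simp [hxC]
        · obtain ⟨s, hs, hsk, hsr⟩ := hd r hr k hk
          refine ⟨s, hs.lt, hs, fun i hi x hxy hx => ?_⟩
          rcases eq_or_ne i k with rfl | hik
          · refine ⟨fun _ => ?_, fun h => absurd (succ_le_iff.1 h) (lt_irrefl _)⟩
            obtain rfl := hy.unique hx hx₀
            rw [(hcn.isString hs).entry_bit hi] at hsk
            rw [hAy i x hx, hsk]
            cases b <;> simp [hxC]
          · rw [hsr i hi hik 1]
            exact ⟨fun h => (hrA i hi x hxy hx).1 ((lt_add_one_iff.1 h).lt_of_ne hik),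
              fun h => (hrA i hi x hxy hx).2 (succ_le_iff.1 h).le⟩
    obtain ⟨r, -, hr, hrA⟩ := key n le_rfl
    rw [e, satisfies_pair_iff hcn hy]
    refine ⟨r, hr, fun i x hx => ?_⟩
    have hi := hy.index_lt hx
    exact (agrees_iff (hcn.isString hr) hi).2 ((hrA i hi x hx.value_lt hx).1 hi)
  · obtain rfl := relIsLiteral_iff.1 (h c hc hd)
    obtain rfl := hcn.arity_unique (relIsLiteral_iff.2 rfl).1
    obtain ⟨x, hx⟩ := hy.exists zero_lt_one
    obtain rfl : y = single x := hy.ext (isSeq_single x) fun i hi z hz => by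
      obtain rfl := lt_one_iff'.1 hi
      exact entry_single.2 ⟨rfl, hy.unique hz hx⟩
    subst e
    rw [satisfies_literal, hAy 0 x hx]
    simp [hunit, hφ]

theorem satClass_of_easy {S : Set 𝔐.Num} (h : EasyClass S) : SATClass S := by
  rcases h with h | h | h | h
  · exact satClass_of_zero_valid h
  · exact satClass_of_one_valid h
  · exact satClass_of_default (b := true) h
  · exact satClass_of_default (b := false) h

/-! ### Formulas built from a template -/

/-- The sequence of length `N` with entry `d` at place `j`, and at the other places entry `o` where
`r` has a `1` and entry `z` where it has not. -/
noncomputable def formSeq (N r j z o d : 𝔐.Num) : 𝔐.Num :=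
  mkSet (pair N (z + o + d)) fun p => ∃ i, i < N ∧ ((i = j ∧ p = pair i d) ∨
    (i ≠ j ∧ Entry r i 1 ∧ p = pair i o) ∨ (i ≠ j ∧ ¬ Entry r i 1 ∧ p = pair i z))

/-- The formula with relation `c` and variables `formSeq N r j z o d`. -/
noncomputable def form (c N r j z o d : 𝔐.Num) : 𝔐.Num := pair c (formSeq N r j z o d)

instance RecF.form (c N r j : 𝔐.Num) {z o d : 𝔐.Num → 𝔐.Num} [hz : RecF z] [ho : RecF o]
    [hd : RecF d] : RecF (fun a => form c N r j (z a) (o a) (d a)) := by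
  have hz' := @RecF.comp₁ _ _ _ hz
  have ho' := @RecF.comp₁ _ _ _ ho
  have hd' := @RecF.comp₁ _ _ _ hd
  unfold L2Structure.form formSeq
  infer_instance

section Form

variable {c N r j z o d i x : 𝔐.Num} {A : Set 𝔐.Num}

theorem entry_formSeq : Entry (formSeq N r j z o d) i x ↔ i < N ∧ ((i = j ∧ x = d) ∨
    (i ≠ j ∧ Entry r i 1 ∧ x = o) ∨ (i ≠ j ∧ ¬ Entry r i 1 ∧ x = z)) := by
  rw [Entry, formSeq, fmem_mkSet]
  constructor
  · rintro ⟨-, i', hi, h⟩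
    simp only [pair_inj] at h
    rcases h with ⟨h, rfl, rfl⟩ | ⟨h, h', rfl, rfl⟩ | ⟨h, h', rfl, rfl⟩
    exacts [⟨hi, .inl ⟨h, rfl⟩⟩, ⟨hi, .inr (.inl ⟨h, h', rfl⟩)⟩, ⟨hi, .inr (.inr ⟨h, h', rfl⟩)⟩]
  · rintro ⟨hi, h⟩
    refine ⟨pair_lt_pair hi ?_, i, hi, ?_⟩
    · rcases h with ⟨-, rfl⟩ | ⟨-, -, rfl⟩ | ⟨-, -, rfl⟩
      exacts [le_add_self, le_add_self.trans le_self_add, le_self_add.trans le_self_add]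
    · rcases h with ⟨h, rfl⟩ | ⟨h, h', rfl⟩ | ⟨h, h', rfl⟩
      exacts [.inl ⟨h, rfl⟩, .inr (.inl ⟨h, h', rfl⟩), .inr (.inr ⟨h, h', rfl⟩)]

theorem isSeq_formSeq (N r j z o d : 𝔐.Num) : IsSeq (formSeq N r j z o d) N := by
  refine ⟨isFinset_mkSet _ _, fun p hp => ?_, fun i hi => ?_⟩
  · obtain ⟨-, i, hi, ⟨-, h⟩ | ⟨-, -, h⟩ | ⟨-, -, h⟩⟩ := fmem_mkSet.1 hp
    exacts [⟨i, _, hi, h⟩, ⟨i, _, hi, h⟩, ⟨i, _, hi, h⟩]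
  · simp only [entry_formSeq, hi, true_and]
    by_cases h : i = j
    · simp [h]
    · by_cases h' : Entry r i 1 <;> simp [h, h']

theorem lt_form (h : Entry (formSeq N r j z o d) i x) : x < form c N r j z o d :=
  h.value_lt.trans_le (right_le_pair _ _)

theorem isSFormula_form {S V : Set 𝔐.Num} (hc : c ∈ S) (hcN : IsRel c N) (hV : ∀ x, x ∈ V) :
    IsSFormula S V (form c N r j z o d) :=
  ⟨c, hc, N, _, rfl, hcN, isSeq_formSeq _ _ _ _ _ _, fun _ x _ => hV x⟩

theorem satisfies_form_iff (hc : IsRel c N) : Satisfies A (form c N r j z o d) ↔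
    ∃ s, RelMem s c ∧ ∀ i, i < N → (i = j → (Entry s i 1 ↔ d ∈ A)) ∧
      (i ≠ j → Entry r i 1 → (Entry s i 1 ↔ o ∈ A)) ∧
      (i ≠ j → ¬ Entry r i 1 → (Entry s i 1 ↔ z ∈ A)) := by
  rw [form, satisfies_pair_iff hc (isSeq_formSeq _ _ _ _ _ _)]
  refine exists_congr fun s => and_congr_right fun hs => ?_
  have hs := hc.isString hs
  constructor
  · intro h i hi
    have h := fun x hx => (agrees_iff hs hi).1 (h i x hx)
    refine ⟨fun h' => h _ (entry_formSeq.2 ⟨hi, .inl ⟨h', rfl⟩⟩),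
      fun h' h'' => h _ (entry_formSeq.2 ⟨hi, .inr (.inl ⟨h', h'', rfl⟩)⟩),
      fun h' h'' => h _ (entry_formSeq.2 ⟨hi, .inr (.inr ⟨h', h'', rfl⟩)⟩)⟩
  · intro h i x hx
    obtain ⟨hi, hx⟩ := entry_formSeq.1 hx
    rw [agrees_iff hs hi]
    obtain ⟨h1, h2, h3⟩ := h i hi
    rcases hx with ⟨e, rfl⟩ | ⟨e, e', rfl⟩ | ⟨e, e', rfl⟩
    exacts [h1 e, h2 e e', h3 e e']

/-- Under these values the variables of the template spell out `r` itself. Taking `j = N` leaves no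
place for `d` and makes `hd` vacuous. -/
theorem satisfies_form (hc : IsRel c N) (hr : RelMem r c) (hz : z ∉ A) (ho : o ∈ A)
    (hd : j < N → (d ∈ A ↔ Entry r j 1)) : Satisfies A (form c N r j z o d) := by
  rw [satisfies_form_iff hc]
  refine ⟨r, hr, fun i hi => ⟨?_, fun _ h => iff_of_true h ho, fun _ h => iff_of_false h hz⟩⟩
  rintro rfl
  exact (hd hi).symm

theorem satisfies_form_of_valid (hc : RelValid 1 c) (hcN : IsRel c N) (hz : z ∈ A) (ho : o ∈ A) :
    Satisfies A (form c N r N z o d) := by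
  obtain ⟨N', s, hcN', hs, h⟩ := hc
  obtain rfl := hcN.arity_unique hcN'
  rw [satisfies_form_iff hcN]
  exact ⟨s, hs, fun i hi => ⟨fun h => absurd h hi.ne, fun _ _ => iff_of_true (h i hi) ho,
    fun _ _ => iff_of_true (h i hi) hz⟩⟩

theorem satisfies_form_of_zero_valid (hc : RelValid 0 c) (hcN : IsRel c N) (hz : z ∉ A)
    (ho : o ∉ A) : Satisfies A (form c N r N z o d) := by
  obtain ⟨N', s, hcN', hs, h⟩ := hc
  obtain rfl := hcN.arity_unique hcN'
  have h : ∀ i, i < N → ¬ Entry s i 1 :=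
    fun i hi => ((hcN.isString hs).zero_iff hi).1 (h i hi)
  rw [satisfies_form_iff hcN]
  exact ⟨s, hs, fun i hi => ⟨fun h => absurd h hi.ne, fun _ _ => iff_of_false (h i hi) ho,
    fun _ _ => iff_of_false (h i hi) hz⟩⟩

theorem relValid_one_of_satisfies (hcN : IsRel c N) (h : Satisfies A (form c N r N z o d))
    (hz : z ∈ A) (ho : o ∈ A) : RelValid 1 c := by
  obtain ⟨s, hs, h⟩ := (satisfies_form_iff hcN).1 h
  refine ⟨N, s, hcN, hs, fun i hi => ?_⟩
  by_cases hr : Entry r i 1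
  exacts [((h i hi).2.1 hi.ne hr).2 ho, ((h i hi).2.2 hi.ne hr).2 hz]

theorem relValid_zero_of_satisfies (hcN : IsRel c N) (h : Satisfies A (form c N r N z o d))
    (hz : z ∉ A) (ho : o ∉ A) : RelValid 0 c := by
  obtain ⟨s, hs, h⟩ := (satisfies_form_iff hcN).1 h
  refine ⟨N, s, hcN, hs, fun i hi => ?_⟩
  rw [(hcN.isString hs).zero_iff hi]
  by_cases hr : Entry r i 1
  exacts [fun h' => ho (((h i hi).2.1 hi.ne hr).1 h'), fun h' => hz (((h i hi).2.2 hi.ne hr).1 h')]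

end Form

/-! ### Separation -/

variable (𝔐) in
/-- `Σ⁰₁` separation for pairs of enumerated sets: if no number is enumerated both by `D true` and by
`D false`, some set contains all numbers of the first kind and none of the second. -/
def Separation : Prop :=
  ∀ D : Bool → Set 𝔐.Num, (∀ b, D b ∈ 𝔐.sets) →
    (∀ n s t, pair n s ∈ D true → pair n t ∉ D false) →
    ∃ X ∈ 𝔐.sets, ∀ b n s, pair n s ∈ D b → (n ∈ X ↔ b = true)

/-- The assignment making true the variables `(1, t)`, and `(2, n)` for `n ∈ B`. -/
def canon (B : Set 𝔐.Num) : Set 𝔐.Num := {v | fst v = 1 ∨ (fst v = 2 ∧ snd v ∈ B)}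

theorem pair_zero_notMem_canon (B : Set 𝔐.Num) (s : 𝔐.Num) : pair 0 s ∉ canon B := by
  simp [canon]

theorem pair_one_mem_canon (B : Set 𝔐.Num) (s : 𝔐.Num) : pair 1 s ∈ canon B := by
  simp [canon]

theorem pair_two_mem_canon {B : Set 𝔐.Num} {n : 𝔐.Num} : pair 2 n ∈ canon B ↔ n ∈ B := by
  simp [canon]

/-- Separation from families of formulas: `K` fixes constants, and `G b n s` fixes the value of the
variable `(2, n)` to `b`, up to a global flip of all truth values. -/
theorem separation_of_gadgets {S : Set 𝔐.Num} (hSAT : SATClass S) (K : Set 𝔐.Num)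
    (hKsets : K ∈ 𝔐.sets) (G : Bool → 𝔐.Num → 𝔐.Num → 𝔐.Num)
    (hGrec : ∀ b, ∀ f g : 𝔐.Num → 𝔐.Num, [RecF f] → [RecF g] → RecF (fun a => G b (f a) (g a)))
    (hK : ∀ V : Set 𝔐.Num, (∀ x, x ∈ V) → ∀ φ ∈ K, IsSFormula S V φ)
    (hG : ∀ V : Set 𝔐.Num, (∀ x, x ∈ V) → ∀ b n s, IsSFormula S V (G b n s))
    (hle : ∀ b n s, n ≤ G b n s ∧ s ≤ G b n s)
    (hKsat : ∀ B, ∀ φ ∈ K, Satisfies (canon B) φ)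
    (hGsat : ∀ B b n s, (n ∈ B ↔ b = true) → Satisfies (canon B) (G b n s))
    (hforce : ∀ A, (∀ φ ∈ K, Satisfies A φ) →
      ∃ q : Bool, ∀ b n s, Satisfies A (G b n s) → (pair 2 n ∈ A ↔ b = q)) : 𝔐.Separation := by
  intro D hD hdisj
  have hKrec := RecP.of_mem hKsets
  have hDt := RecP.of_mem (hD true)
  have hDf := RecP.of_mem (hD false)
  -- By `hle` the search for `n` and `s` is bounded by the formula, so `C` is a set of the model.
  let C : Set 𝔐.Num := {φ | φ ∈ K ∨ ∃ n, n ≤ φ ∧ ∃ s, s ≤ φ ∧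
    ((pair n s ∈ D true ∧ φ = G true n s) ∨
      (pair n s ∈ D false ∧ φ = G false n s))}
  have hC : C ∈ 𝔐.sets := RecP.mem_sets
  have hCr := RecP.of_mem hC
  have hCiff : ∀ φ, φ ∈ C ↔ φ ∈ K ∨ ∃ b n s, pair n s ∈ D b ∧ φ = G b n s := by
    intro φ
    refine or_congr_right ⟨?_, ?_⟩
    · rintro ⟨n, -, s, -, h | h⟩
      exacts [⟨true, n, s, h⟩, ⟨false, n, s, h⟩]
    · rintro ⟨b, n, s, h, rfl⟩
      refine ⟨n, (hle b n s).1, s, (hle b n s).2, ?_⟩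
      cases b
      exacts [.inr ⟨h, rfl⟩, .inl ⟨h, rfl⟩]
  obtain ⟨A, hA, -, hAC⟩ := hSAT {x | True} RecP.mem_sets (fun k => ⟨k, trivial, lt_irrefl k⟩) C hC
    (fun φ hφ => by
      rcases (hCiff φ).1 hφ with h | ⟨b, n, s, -, rfl⟩
      exacts [hK _ (fun _ => trivial) φ h, hG _ (fun _ => trivial) b n s])
    (fun F hF hFC ⟨k, hk⟩ => by
      -- A finite part with codes below `k` mentions only stages below `k`, so enumeration can stop
      -- there, which makes the assignment recursive.
      refine ⟨canon {n | ∃ s, s < k ∧ pair n s ∈ D true}, RecP.mem_sets (P := fun v => fst v = 1 ∨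
        (fst v = 2 ∧ ∃ s, s < k ∧ pair (snd v) s ∈ D true)), fun _ _ => trivial, fun φ hφ => ?_⟩
      rcases (hCiff φ).1 (hFC hφ) with h | ⟨b, n, s, h, rfl⟩
      · exact hKsat _ φ h
      · refine hGsat _ b n s ?_
        cases b
        · simp only [Set.mem_ofPred_eq, Bool.false_eq_true, iff_false]
          rintro ⟨t, -, ht⟩
          exact hdisj n t s ht h
        · exact iff_of_true ⟨s, (hle true n s).2.trans_lt (hk _ hφ), h⟩ rfl)
  have hAr := RecP.of_mem hA
  obtain ⟨q, hq⟩ := hforce A fun φ hφ => hAC φ ((hCiff φ).2 (.inl hφ))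
  have hX : {n | pair (2 : 𝔐.Num) n ∈ A ↔ q = true} ∈ 𝔐.sets := RecP.mem_sets
  refine ⟨{n | pair 2 n ∈ A ↔ q = true}, hX, fun b n s h => ?_⟩
  have := hq b n s (hAC _ ((hCiff _).2 (.inr ⟨b, n, s, h, rfl⟩)))
  rw [Set.mem_ofPred_eq, this]
  cases b <;> cases q <;> simp

/-- A vector `r` of the relation has both values. Putting `z` at its zeros and `o` at its ones gives
a constraint that holds for `(z, o) = (0, 1)` and fails whenever `z = o`, so it forces `z ≠ o`. The
family `K` makes every `(0, s)` differ from every `(1, t)`, so all copies of a constant agree; the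
value of `(1, 0)` decides the flip. -/
theorem separation_of_not_valid {S : Set 𝔐.Num} (hSAT : SATClass S) {c N : 𝔐.Num} (hc : c ∈ S)
    (hcN : IsRel c N) (h0 : ¬ RelValid 0 c) (h1 : ¬ RelValid 1 c) : 𝔐.Separation := by
  obtain ⟨r, hr⟩ := hcN.exists_mem
  have hrs := hcN.isString hr
  obtain ⟨i₁, hi₁, hri₁⟩ : ∃ i, i < N ∧ Entry r i 1 := by
    by_contra! h
    exact h0 ⟨N, r, hcN, hr, fun i hi => (hrs.zero_iff hi).2 (h i hi)⟩
  obtain ⟨i₀, hi₀, hri₀⟩ : ∃ i, i < N ∧ ¬ Entry r i 1 := by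
    by_contra! h
    exact h1 ⟨N, r, hcN, hr, h⟩
  -- Both `z` and `o` really occur, because `r` is not constant; this bounds the labels by the
  -- formula.
  have hz : ∀ z o, z ≤ form c N r N z o 0 := fun z o =>
    (lt_form (entry_formSeq.2 ⟨hi₀, .inr (.inr ⟨hi₀.ne, hri₀, rfl⟩)⟩)).le
  have ho : ∀ z o, o ≤ form c N r N z o 0 := fun z o =>
    (lt_form (entry_formSeq.2 ⟨hi₁, .inr (.inl ⟨hi₁.ne, hri₁, rfl⟩)⟩)).le
  have hsat : ∀ {A : Set 𝔐.Num} {z o}, z ∉ A → o ∈ A → Satisfies A (form c N r N z o 0) :=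
    fun hz ho => satisfies_form hcN hr hz ho fun h => absurd h (lt_irrefl _)
  have hiff : ∀ {A : Set 𝔐.Num} {z o}, Satisfies A (form c N r N z o 0) → (z ∈ A ↔ o ∉ A) := by
    intro A z o h
    by_cases hz : z ∈ A <;> by_cases ho : o ∈ A
    · exact absurd (relValid_one_of_satisfies hcN h hz ho) h1
    · simp [hz, ho]
    · simp [hz, ho]
    · exact absurd (relValid_zero_of_satisfies hcN h hz ho) h0
  refine separation_of_gadgets hSAT
    {φ | ∃ s, s ≤ φ ∧ ∃ t, t ≤ φ ∧ φ = form c N r N (pair 0 s) (pair 1 t) 0} ?_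
    (fun b n s => bif b then form c N r N (pair 0 s) (pair 2 n) 0 else
      form c N r N (pair 2 n) (pair 1 s) 0) ?_ ?_ ?_ ?_ ?_ ?_ ?_
  · exact RecP.mem_sets
  · rintro (_ | _) f g hf hg
    exacts [RecF.form c N r N, RecF.form c N r N]
  · rintro V hV φ ⟨s, -, t, -, rfl⟩
    exact isSFormula_form hc hcN hV
  · rintro V hV (_ | _) n s
    exacts [isSFormula_form hc hcN hV, isSFormula_form hc hcN hV]
  · rintro (_ | _) n s
    · exact ⟨(right_le_pair _ _).trans (hz _ _), (right_le_pair _ _).trans (ho _ _)⟩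
    · exact ⟨(right_le_pair _ _).trans (ho _ _), (right_le_pair _ _).trans (hz _ _)⟩
  · rintro B φ ⟨s, -, t, -, rfl⟩
    exact hsat (pair_zero_notMem_canon B s) (pair_one_mem_canon B t)
  · rintro B (_ | _) n s hn
    · exact hsat (by rw [pair_two_mem_canon]; simpa using hn) (pair_one_mem_canon B s)
    · exact hsat (pair_zero_notMem_canon B s) (by rw [pair_two_mem_canon]; simpa using hn)
  · intro A hA
    have hA : ∀ s t, pair 0 s ∈ A ↔ pair 1 t ∉ A := fun s t => hiff (hA _
      ⟨s, (right_le_pair _ _).trans (hz _ _), t, (right_le_pair _ _).trans (ho _ _), rfl⟩)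
    by_cases hq : pair 1 0 ∈ A
    · refine ⟨true, ?_⟩
      rintro (_ | _) n s h
      · have h1 := hiff h; have h2 := hA 0 s; have h3 := hA 0 0
        simp; tauto
      · have h1 := hiff h; have h2 := hA s 0
        simp; tauto
    · refine ⟨false, ?_⟩
      rintro (_ | _) n s h
      · have h1 := hiff h; have h2 := hA 0 s; have h3 := hA 0 0
        simp; tauto
      · have h1 := hiff h; have h2 := hA s 0
        simp; tauto

/-- A relation that is not closed under changing entries to `!b`, and is not `{b}`, has a vector with
a `b` that is forced by the other entries, of which there is at least one. -/
theorem exists_forced {c N : 𝔐.Num} {b : Bool} (hcN : IsRel c N) (hd : ¬ RelDefault (𝔐.bit !b) c)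
    (hl : ¬ RelIsLiteral (𝔐.bit b) c) : ∃ r j, RelMem r c ∧ j < N ∧ (Entry r j 1 ↔ b = true) ∧
      (∀ s, RelMem s c → (∀ k, k < N → k ≠ j → (Entry s k 1 ↔ Entry r k 1)) →
        (Entry s j 1 ↔ b = true)) ∧ ∃ i, i < N ∧ i ≠ j := by
  have hd : ∃ r, RelMem r c ∧ ∃ j, j < N ∧ ∀ s, RelMem s c → Entry s j (𝔐.bit !b) →
      ¬ ∀ k, k < N → k ≠ j → ∀ x, Entry s k x ↔ Entry r k x := by
    by_contra! h
    exact hd ⟨N, hcN, h⟩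
  obtain ⟨r, hr, j, hj, h⟩ := hd
  have hrs := hcN.isString hr
  have key : ∀ s, RelMem s c → (∀ k, k < N → k ≠ j → (Entry s k 1 ↔ Entry r k 1)) →
      (Entry s j 1 ↔ b = true) := by
    intro s hs hsr
    have hss := hcN.isString hs
    by_contra hb
    refine h s hs ?_ fun k hk hkj x => ?_
    · rw [hss.entry_bit hj]
      cases b <;> simpa using hb
    · constructor
      · intro hx
        rcases hss.2 k x hx with rfl | rfl
        · rwa [hrs.zero_iff hk, ← hsr k hk hkj, ← hss.zero_iff hk]
        · rwa [← hsr k hk hkj]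
      · intro hx
        rcases hrs.2 k x hx with rfl | rfl
        · rwa [hss.zero_iff hk, hsr k hk hkj, ← hrs.zero_iff hk]
        · rwa [hsr k hk hkj]
  refine ⟨r, j, hr, hj, key r hr fun _ _ _ => Iff.rfl, key, ?_⟩
  -- If `j` were the only place, the arity would be 1 and every vector would have the entry `b`,
  -- making the relation the excluded literal. The extra place is what later carries the stage
  -- label.
  by_contra! hall
  apply hl
  have hj0 : j = 0 := (hall 0 (hj.trans_le' zero_le)).symm
  subst hj0
  have hN : N = 1 := by
    refine le_antisymm (not_lt.1 fun h => one_ne_zero (hall 1 h)) ?_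
    rw [← zero_add (1 : 𝔐.Num)]
    exact succ_le_iff.2 hj
  subst hN
  refine ⟨hcN, fun s => ⟨fun hs => ⟨hcN.isString hs, ?_⟩, fun ⟨hs, hs0⟩ => ?_⟩⟩
  · rw [(hcN.isString hs).entry_bit hj]
    exact key s hs fun k hk hk0 => absurd (hall k hk) hk0
  · have : s = r := hs.ext hrs fun i hi => by
      obtain rfl := hall i hi
      rw [key r hr fun _ _ _ => Iff.rfl, ← hs.entry_bit hj]
      exact hs0
    rwa [this]

/-- With a single variable repeated at all places, `R true` forces it to be true and `R false`
forces it to be false, giving genuine constants. Filling these into `Q b` around a forced place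
makes the variable there equal to `b`; no flip can occur. -/
theorem separation_of_forced {S : Set 𝔐.Num} (hSAT : SATClass S) (R : Bool → 𝔐.Num)
    (N : Bool → 𝔐.Num) (hR : ∀ b, R b ∈ S) (hRN : ∀ b, IsRel (R b) (N b))
    (h1 : RelValid 1 (R true)) (h10 : ¬ RelValid 0 (R true)) (h0 : RelValid 0 (R false))
    (h01 : ¬ RelValid 1 (R false)) (Q : Bool → 𝔐.Num) (M : Bool → 𝔐.Num) (hQ : ∀ b, Q b ∈ S)
    (hQM : ∀ b, IsRel (Q b) (M b)) (hd : ∀ b, ¬ RelDefault (𝔐.bit !b) (Q b))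
    (hl : ∀ b, ¬ RelIsLiteral (𝔐.bit b) (Q b)) : 𝔐.Separation := by
  -- A nonempty relation of arity 0 is vacuously 0-valid and 1-valid, so it is neither of these two.
  have hpos : ∀ b, 0 < N b := by
    intro b
    refine pos_of_ne_zero fun hb => ?_
    obtain ⟨s, hs⟩ := (hRN b).exists_mem
    have := fun i => (hb ▸ not_lt_zero : ¬ i < N b)
    cases b
    exacts [h01 ⟨_, s, hRN _, hs, fun i hi => absurd hi (this i)⟩,
      h10 ⟨_, s, hRN _, hs, fun i hi => absurd hi (this i)⟩]
  -- Since `v` plays both `z` and `o`, the template vector is irrelevant and the number 0 serves.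
  have hconst : ∀ b v, v ≤ form (R b) (N b) 0 (N b) v v 0 := by
    intro b v
    refine (lt_form (i := 0) (entry_formSeq.2 ⟨hpos b, ?_⟩)).le
    by_cases h : Entry (0 : 𝔐.Num) 0 1
    exacts [.inr (.inl ⟨(hpos b).ne, h, rfl⟩), .inr (.inr ⟨(hpos b).ne, h, rfl⟩)]
  choose r j hr hj hrj hforced hi using fun b => exists_forced (hQM b) (hd b) (hl b)
  refine separation_of_gadgets hSAT
    {φ | ∃ s, s ≤ φ ∧ (φ = form (R true) (N true) 0 (N true) (pair 1 s) (pair 1 s) 0 ∨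
      φ = form (R false) (N false) 0 (N false) (pair 0 s) (pair 0 s) 0)} ?_
    (fun b n s => form (Q b) (M b) (r b) (j b) (pair 0 s) (pair 1 s) (pair 2 n)) ?_ ?_ ?_ ?_ ?_ ?_ ?_
  · exact RecP.mem_sets
  · exact fun b f g _ _ => RecF.form _ _ _ _
  · rintro V hV φ ⟨s, -, rfl | rfl⟩
    exacts [isSFormula_form (hR _) (hRN _) hV, isSFormula_form (hR _) (hRN _) hV]
  · exact fun V hV b n s => isSFormula_form (hQ b) (hQM b) hV
  · intro b n s
    constructor
    · exact (right_le_pair _ _).trans (lt_form (entry_formSeq.2 ⟨hj b, .inl ⟨rfl, rfl⟩⟩)).le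
    · obtain ⟨i, hi, hij⟩ := hi b
      by_cases h : Entry (r b) i 1
      · exact (right_le_pair _ _).trans
          (lt_form (entry_formSeq.2 ⟨hi, .inr (.inl ⟨hij, h, rfl⟩)⟩)).le
      · exact (right_le_pair _ _).trans
          (lt_form (entry_formSeq.2 ⟨hi, .inr (.inr ⟨hij, h, rfl⟩)⟩)).le
  · rintro B φ ⟨s, -, rfl | rfl⟩
    · exact satisfies_form_of_valid h1 (hRN _) (pair_one_mem_canon B s) (pair_one_mem_canon B s)
    · exact satisfies_form_of_zero_valid h0 (hRN _) (pair_zero_notMem_canon B s)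
        (pair_zero_notMem_canon B s)
  · intro B b n s hn
    refine satisfies_form (hQM b) (hr b) (pair_zero_notMem_canon B s) (pair_one_mem_canon B s)
      fun _ => ?_
    rw [pair_two_mem_canon, hn, hrj]
  · intro A hA
    refine ⟨true, fun b n s h => ?_⟩
    have ho : pair 1 s ∈ A := by
      by_contra ho
      exact h10 (relValid_zero_of_satisfies (hRN true) (hA _
        ⟨s, (right_le_pair _ _).trans (hconst true _), .inl rfl⟩) ho ho)
    have hz : pair 0 s ∉ A := fun hz =>
      h01 (relValid_one_of_satisfies (hRN false) (hA _
        ⟨s, (right_le_pair _ _).trans (hconst false _), .inr rfl⟩) hz hz)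
    obtain ⟨t, ht, h⟩ := (satisfies_form_iff (hQM b)).1 h
    rw [← (h _ (hj b)).1 rfl]
    refine hforced b t ht fun k hk hkj => ?_
    by_cases hrk : Entry (r b) k 1
    · exact iff_of_true (((h k hk).2.1 hkj hrk).2 ho) hrk
    · exact iff_of_false (fun h' => hz (((h k hk).2.2 hkj hrk).1 h')) hrk

/-- The failures of (a) and (b) give relations `a` and `b`. If either is neither 0-valid nor
1-valid, it expresses inequality; otherwise they supply the constants 1 and 0, and the failures of
(c) and (d) supply the forced places. -/
theorem separation_of_not_easy {S : Set 𝔐.Num} (hS : ∀ c ∈ S, ∃ n, IsRel c n)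
    (h : ¬ EasyClass S) (hSAT : SATClass S) : 𝔐.Separation := by
  simp only [EasyClass, not_or, not_forall] at h
  obtain ⟨⟨a, ha, ha0⟩, ⟨b, hb, hb1⟩, ⟨c, hc, hcd, hcl⟩, ⟨d, hd, hdd, hdl⟩⟩ := h
  obtain ⟨na, hna⟩ := hS a ha
  obtain ⟨nb, hnb⟩ := hS b hb
  obtain ⟨nc, hnc⟩ := hS c hc
  obtain ⟨nd, hnd⟩ := hS d hd
  by_cases ha1 : RelValid 1 a
  · by_cases hb0 : RelValid 0 b
    · exact separation_of_forced hSAT (fun x => bif x then a else b) (fun x => bif x then na else nb)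
        (by rintro (_ | _); exacts [hb, ha]) (by rintro (_ | _); exacts [hnb, hna]) ha1 ha0 hb0 hb1
        (fun x => bif x then c else d) (fun x => bif x then nc else nd)
        (by rintro (_ | _); exacts [hd, hc]) (by rintro (_ | _); exacts [hnd, hnc])
        (by rintro (_ | _); exacts [hdd, hcd]) (by rintro (_ | _); exacts [hdl, hcl])
    · exact separation_of_not_valid hSAT hb hnb hb0 hb1
  · exact separation_of_not_valid hSAT ha hna ha0 ha1

/-! ### Weak König's lemma from separation -/

/-- The restriction of the binary string `s` to its first `i` entries. -/
noncomputable def restr (s i : 𝔐.Num) : 𝔐.Num := mkString i fun k => Entry s k 1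

instance RecF.restr {f g : 𝔐.Num → 𝔐.Num} [hf : RecF f] [hg : RecF g] :
    RecF (fun a => restr (f a) (g a)) := by
  have hf' := @RecF.comp₁ _ _ _ hf
  exact RecF.mkString (f := g) (P := fun a k => Entry (f a) k 1)

section Restr

variable {s t i k l : 𝔐.Num}

theorem entry_restr (h : k < i) : Entry (restr s i) k 1 ↔ Entry s k 1 := entry_mkString_one h

theorem isString_restr (s i : 𝔐.Num) : IsString (restr s i) i := isString_mkString _ _

theorem restr_congr (h : ∀ k, k < i → (Entry s k 1 ↔ Entry t k 1)) : restr s i = restr t i :=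
  (isString_restr s i).ext (isString_restr t i) fun k hk => by
    rw [entry_restr hk, entry_restr hk, h k hk]

theorem restr_self (hs : IsString s l) : restr s l = s :=
  (isString_restr s l).ext hs fun _ hk => entry_restr hk

theorem isInit_restr (hs : IsString s l) (h : i ≤ l) : IsInit (restr s i) i s :=
  (isInit_iff hs (isString_restr s i) h).2 fun _ hk => entry_restr hk

theorem IsBinTree.restr_mem {T : Set 𝔐.Num} (hT : IsBinTree T) (hs : IsString s l) (h : i ≤ l)
    (hsT : s ∈ T) : restr s i ∈ T :=
  hT.2 s hsT l i _ hs h (isInit_restr hs h)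

/-- Strings shorter than `l` have codes below a fixed bound, so an unbounded tree has a string of
length at least `l`, which can be cut down. -/
theorem IsBinTree.exists_mem {T : Set 𝔐.Num} (hT : IsBinTree T) (hinf : Infinite T) (l : 𝔐.Num) :
    ∃ s ∈ T, IsString s l := by
  obtain ⟨s, hs, hsl⟩ := hinf (codeBound (pair l 1))
  obtain ⟨l', hl'⟩ := hT.1 s hs
  rcases le_or_gt l l' with h | h
  · exact ⟨_, hT.restr_mem hl' h hs, isString_restr s l⟩
  · refine absurd (hl'.1.1.lt_codeBound fun p hp => ?_) hsl
    obtain ⟨i, x, hi, rfl⟩ := hl'.1.2.1 p hp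
    rcases hl'.2 i x hp with rfl | rfl
    exacts [pair_lt_pair (hi.trans h) zero_le, pair_lt_pair (hi.trans h) le_rfl]

end Restr

/-- Some string of length `l` in `T` agrees with `s` below `m` and has value `b` at `m`. -/
def ExtendsTo (T : Set 𝔐.Num) (b : Bool) (s m l : 𝔐.Num) : Prop :=
  ∃ t, t < codeBound (pair l 1) ∧ (IsString t l ∧ t ∈ T ∧
    (∀ i, i < m → (Entry t i 1 ↔ Entry s i 1)) ∧ (Entry t m 1 ↔ b = true))

instance RecP.extendsTo {T : Set 𝔐.Num} [RecP (fun a => a ∈ T)] {b : Bool}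
    {f g h : 𝔐.Num → 𝔐.Num} [hf : RecF f] [hg : RecF g] [hh : RecF h] :
    RecP (fun a => ExtendsTo T b (f a) (g a) (h a)) := by
  have hf' := @RecF.comp₁ _ _ _ hf
  have hg' := @RecF.comp₁ _ _ _ hg
  have hh' := @RecF.comp₁ _ _ _ hh
  unfold ExtendsTo
  infer_instance

theorem ExtendsTo.mono {T : Set 𝔐.Num} (hT : IsBinTree T) {b : Bool} {s m l l' : 𝔐.Num}
    (h : ExtendsTo T b s m l') (hm : m < l) (hl : l ≤ l') : ExtendsTo T b s m l := by
  obtain ⟨t, -, ht, htT, hts, htb⟩ := h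
  refine ⟨restr t l, (isString_restr t l).lt_codeBound, isString_restr t l, hT.restr_mem ht hl htT,
    fun i hi => ?_, ?_⟩
  · rw [entry_restr (hi.trans hm), hts i hi]
  · rw [entry_restr hm, htb]

/-- The string `s` of length `m` follows the strategy `X`. -/
def Follows (X : Set 𝔐.Num) (s m : 𝔐.Num) : Prop :=
  IsString s m ∧ ∀ i, i < m → (Entry s i 1 ↔ pair (restr s i) i ∈ X)

instance RecP.follows {X : Set 𝔐.Num} [RecP (fun a => a ∈ X)] {f g : 𝔐.Num → 𝔐.Num}
    [hf : RecF f] [hg : RecF g] : RecP (fun a => Follows X (f a) (g a)) :=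
  RecP.comp₂ (R := Follows X) (by unfold Follows; infer_instance) f g

section Follows

variable {X : Set 𝔐.Num}

theorem exists_follows [RecP (fun a => a ∈ X)] (m : 𝔐.Num) : ∃ s, Follows X s m := by
  refine sigma_induction (P := fun m s => Follows X s m) ?_ ?_ m
  · exact ⟨_, isString_mkString 0 fun _ => False, fun i hi => absurd hi not_lt_zero⟩
  · rintro m s ⟨hs, h⟩
    let P : 𝔐.Num → Prop := fun i => (i < m ∧ Entry s i 1) ∨ (i = m ∧ pair s m ∈ X)
    have hP : RecP P := inferInstance
    have hm : m < m + 1 := lt_add_one_iff.2 le_rfl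
    have hlt : ∀ i, i < m → (Entry (mkString (m + 1) P) i 1 ↔ Entry s i 1) := by
      intro i hi
      rw [entry_mkString_one (hi.trans hm)]
      simp [P, hi, hi.ne]
    refine ⟨_, isString_mkString (m + 1) P, fun i hi => ?_⟩
    rcases (lt_add_one_iff.1 hi).lt_or_eq with hi | rfl
    · rw [hlt i hi, h i hi, restr_congr fun k hk => hlt k (hk.trans hi)]
    · rw [restr_congr hlt, restr_self hs, entry_mkString_one hm]
      simp [P]

theorem Follows.entry_iff {s t m n : 𝔐.Num} (hs : Follows X s m) (ht : Follows X t n) :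
    ∀ i, i < m → i < n → (Entry s i 1 ↔ Entry t i 1) := by
  refine rec_strong_induction (P := fun i => i < m → i < n → (Entry s i 1 ↔ Entry t i 1))
    fun i ih him hin => ?_
  rw [hs.2 i him, ht.2 i hin, restr_congr fun k hk => ih k hk (hk.trans him) (hk.trans hin)]

end Follows

/-- A node is enumerated by `D b` at stage `l` if its side `b` has an extension of length `l` in `T`
and the other side has none. A separating set is a strategy choosing a side at every node, never one
that dies out before the other, and following it traces a path. -/
theorem wkl_of_separation (h : 𝔐.Separation) : 𝔐.WKL := by
  intro T hT htree hinf
  have hTr := RecP.of_mem hT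
  let D : Bool → Set 𝔐.Num := fun b => {p | snd (fst p) < snd p ∧
    ExtendsTo T b (fst (fst p)) (snd (fst p)) (snd p) ∧
    ¬ ExtendsTo T (!b) (fst (fst p)) (snd (fst p)) (snd p)}
  -- Disjointness: an extension to the larger stage restricts to the smaller one, which exceeds the
  -- length of the node, and contradicts the negative condition there.
  obtain ⟨X, hX, hXD⟩ := h D (fun b => RecP.mem_sets) (by
    rintro n s t ⟨hs, hs1, hs0⟩ ⟨ht, ht0, ht1⟩
    simp only [fst_pair, snd_pair] at *
    rcases le_total s t with hst | hst
    · exact hs0 (ht0.mono htree hs hst)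
    · exact ht1 (hs1.mono htree ht hst))
  have hXr := RecP.of_mem hX
  let P : Set 𝔐.Num :=
    {i | ∃ s, s < codeBound (pair (i + 1) 1) ∧ (Follows X s (i + 1) ∧ Entry s i 1)}
  refine ⟨P, RecP.mem_sets, fun l => ?_⟩
  obtain ⟨s, hs⟩ := exists_follows (X := X) l
  refine ⟨s, ?_, hs.1, fun i hi => ?_⟩
  · obtain ⟨t, -, ht, htT, hts⟩ : ∃ t, t < codeBound (pair l 1) ∧ (IsString t l ∧ t ∈ T ∧
        ∀ i, i < l → (Entry t i 1 ↔ Entry s i 1)) := by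
      -- Fixing the final length `l` avoids asserting infinitely many extensions: the claim only
      -- says that `s` below `m` extends to length `l` in `T`, which is a recursive condition.
      suffices key : ∀ m, m ≤ l → ∃ t, t < codeBound (pair l 1) ∧ (IsString t l ∧ t ∈ T ∧
        ∀ i, i < m → (Entry t i 1 ↔ Entry s i 1)) from key l le_rfl
      refine rec_induction ?_ ?_
      · intro _
        obtain ⟨t, htT, ht⟩ := htree.exists_mem hinf l
        exact ⟨t, ht.lt_codeBound, ht, htT, fun i hi => absurd hi not_lt_zero⟩
      · intro m ih hm
        have hm := succ_le_iff.1 hm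
        obtain ⟨t, htb, ht, htT, hts⟩ := ih hm.le
        obtain ⟨b, hb⟩ : ∃ b : Bool, Entry t m 1 ↔ b = true := by
          by_cases h : Entry t m 1
          exacts [⟨true, by simpa using h⟩, ⟨false, by simpa using h⟩]
        by_cases heq : Entry t m 1 ↔ Entry s m 1
        · refine ⟨t, htb, ht, htT, fun i hi => ?_⟩
          rcases (lt_add_one_iff.1 hi).lt_or_eq with hi | rfl
          exacts [hts i hi, heq]
        · by_cases hext : ExtendsTo T (!b) (restr s m) m l
          · obtain ⟨t', htb', ht', htT', hts', hb'⟩ := hext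
            refine ⟨t', htb', ht', htT', fun i hi => ?_⟩
            rcases (lt_add_one_iff.1 hi).lt_or_eq with hi | rfl
            · rw [hts' i hi, entry_restr hi]
            · rw [hb] at heq
              rw [hb']
              cases b <;> simp at heq ⊢ <;> exact heq
          -- Only the side of `t` reaches length `l`, so the node is enumerated by `D b` at stage
          -- `l` and the strategy must have chosen `b`.
          · refine absurd ?_ heq
            rw [hb, hs.2 m hm]
            refine (hXD b _ l ⟨?_, ?_, ?_⟩).symm
            · simpa using hm
            · simp only [fst_pair, snd_pair]
              exact ⟨t, htb, ht, htT, fun i hi => by rw [hts i hi, entry_restr hi], hb⟩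
            · simpa using hext
    rwa [← ht.ext hs.1 hts]
  · have hi1 : i < i + 1 := lt_add_one_iff.2 le_rfl
    constructor
    · intro h
      obtain ⟨t, ht⟩ := exists_follows (X := X) (i + 1)
      exact ⟨t, ht.1.lt_codeBound, ht, (hs.entry_iff ht i hi hi1).1 h⟩
    · rintro ⟨t, -, ht, h⟩
      exact (hs.entry_iff ht i hi hi1).2 h

/-! ### Standard numbers and Boolean relations of the metatheory -/

theorem numeral_eq_cast (n : ℕ) : 𝔐.numeral n = n := by
  induction n with
  | zero => exact Nat.cast_zero.symm
  | succ n ih => rw [numeral, ih, Nat.cast_succ]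

theorem numeral_one : 𝔐.numeral 1 = 1 := by simp [numeral_eq_cast]

theorem numeral_inj {m n : ℕ} : 𝔐.numeral m = 𝔐.numeral n ↔ m = n := by
  simp [numeral_eq_cast]

/-- No nonstandard number lies below a standard one, so quantifiers over the places of a relation of
standard arity mean the same inside and outside the model. -/
theorem lt_numeral_iff {x : 𝔐.Num} {n : ℕ} :
    x < 𝔐.numeral n ↔ ∃ i : Fin n, x = 𝔐.numeral i := by
  induction n with
  | zero => exact ⟨fun h => absurd h not_lt_zero, fun ⟨i, _⟩ => i.elim0⟩
  | succ n ih =>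
    rw [numeral, lt_add_one_iff, le_iff_lt_or_eq, ih]
    constructor
    · rintro (⟨i, rfl⟩ | rfl)
      exacts [⟨i.castSucc, rfl⟩, ⟨Fin.last n, rfl⟩]
    · rintro ⟨i, rfl⟩
      induction i using Fin.lastCases with
      | last => exact .inr rfl
      | cast i => exact .inl ⟨i, rfl⟩

theorem numeral_lt {n : ℕ} (i : Fin n) : 𝔐.numeral i < 𝔐.numeral n := lt_numeral_iff.2 ⟨i, rfl⟩

theorem RecP.of_finite {X : Set 𝔐.Num} (h : X.Finite) : RecP (fun a => a ∈ X) := by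
  induction X, h using Set.Finite.induction_on with
  | empty => exact RecP.const False
  | @insert a X _ _ ih =>
    exact RecP.congr (P := fun b => b = a ∨ b ∈ X) inferInstance fun b => Set.mem_insert_iff.symm

open Classical in
/-- The standard vector given by the binary string `s`. -/
noncomputable def toVec {n : ℕ} (s : 𝔐.Num) : Fin n → Bool := fun i => decide (Entry s (𝔐.numeral i) 1)

theorem entry_bit_iff {n : ℕ} {s : 𝔐.Num} (hs : IsString s (𝔐.numeral n)) (i : Fin n) (b : Bool) :
    Entry s (𝔐.numeral i) (𝔐.bit b) ↔ toVec s i = b := by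
  rw [hs.entry_bit (numeral_lt i), toVec]
  cases b <;> simp

theorem toVec_injective {n : ℕ} {s t : 𝔐.Num} (hs : IsString s (𝔐.numeral n))
    (ht : IsString t (𝔐.numeral n)) (h : (toVec s : Fin n → Bool) = toVec t) : s = t := by
  refine hs.ext ht fun x hx => ?_
  obtain ⟨i, rfl⟩ := lt_numeral_iff.1 hx
  simpa [toVec] using congrFun h i

theorem exists_toVec {n : ℕ} (r : Fin n → Bool) :
    ∃ s : 𝔐.Num, IsString s (𝔐.numeral n) ∧ toVec s = r := by
  have : RecP (fun x => x ∈ {x | ∃ i : Fin n, 𝔐.numeral i = x ∧ r i = true}) :=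
    RecP.of_finite ((Set.finite_range fun i : Fin n => 𝔐.numeral i).subset
      fun x ⟨i, hi, _⟩ => ⟨i, hi⟩)
  refine ⟨_, isString_mkString _ fun x => x ∈ {x | ∃ i : Fin n, 𝔐.numeral i = x ∧ r i = true}, ?_⟩
  funext i
  rw [Bool.eq_iff_iff]
  simp only [toVec, decide_eq_true_eq, entry_mkString_one (numeral_lt i)]
  constructor
  · rintro ⟨j, hj, h⟩
    rwa [← Fin.ext (numeral_inj.1 hj)]
  · exact fun h => ⟨i, rfl, h⟩

/-! ### Transfer between relations and their codes -/

section CodesRel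

variable {c : 𝔐.Num} {R : BoolRel} {b : Bool}

theorem CodesRel.relMem_iff (h : CodesRel c R) {s : 𝔐.Num}
    (hs : IsString s (𝔐.numeral R.arity)) : RelMem s c ↔ toVec s ∈ R.rel := by
  rw [h.2]
  constructor
  · exact fun h' => ⟨s, h', fun i => (entry_bit_iff hs i _).2 rfl⟩
  · rintro ⟨t, ht, h'⟩
    have hts := h.1.isString ht
    rwa [toVec_injective hs hts (funext fun i => ((entry_bit_iff hts i _).1 (h' i)).symm)]

theorem CodesRel.relValid_iff (h : CodesRel c R) : RelValid (𝔐.bit b) c ↔ R.Valid b := by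
  constructor
  · rintro ⟨n, s, hn, hs, hb⟩
    obtain rfl := hn.arity_unique h.1
    have hs' := h.1.isString hs
    have : toVec s = fun _ : Fin R.arity => b :=
      funext fun i => (entry_bit_iff hs' i b).1 (hb _ (numeral_lt i))
    rw [BoolRel.Valid, ← this]
    exact (h.relMem_iff hs').1 hs
  · intro hb
    obtain ⟨s, hs, hsb⟩ := exists_toVec (𝔐 := 𝔐) fun _ : Fin R.arity => b
    refine ⟨_, s, h.1, (h.relMem_iff hs).2 (hsb ▸ hb), fun x hx => ?_⟩
    obtain ⟨i, rfl⟩ := lt_numeral_iff.1 hx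
    exact (entry_bit_iff hs i b).2 (congrFun hsb i)

theorem CodesRel.relDefault_iff (h : CodesRel c R) : RelDefault (𝔐.bit b) c ↔ R.Default b := by
  constructor
  · rintro ⟨n, hn, hd⟩ r hr j
    obtain rfl := hn.arity_unique h.1
    obtain ⟨s, hs, rfl⟩ := exists_toVec (𝔐 := 𝔐) r
    obtain ⟨t, ht, htj, hts⟩ := hd s ((h.relMem_iff hs).2 hr) _ (numeral_lt j)
    have ht' := h.1.isString ht
    convert (h.relMem_iff ht').1 ht using 1
    funext k
    rcases eq_or_ne k j with rfl | hk
    · rw [Function.update_self]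
      exact ((entry_bit_iff ht' k b).1 htj).symm
    · rw [Function.update_of_ne hk, eq_comm, ← entry_bit_iff ht' k,
        hts _ (numeral_lt k) (fun e => hk (Fin.ext (numeral_inj.1 e))), entry_bit_iff hs]
  · intro hd
    refine ⟨_, h.1, fun r hr x hx => ?_⟩
    obtain ⟨j, rfl⟩ := lt_numeral_iff.1 hx
    have hrs := h.1.isString hr
    obtain ⟨s, hs, hsr⟩ := exists_toVec (𝔐 := 𝔐) (Function.update (toVec r) j b)
    refine ⟨s, (h.relMem_iff hs).2 (hsr ▸ hd _ ((h.relMem_iff hrs).1 hr) j),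
      (entry_bit_iff hs j b).2 (by rw [hsr, Function.update_self]), fun y hy hyj => ?_⟩
    obtain ⟨k, rfl⟩ := lt_numeral_iff.1 hy
    have hk : k ≠ j := by rintro rfl; exact hyj rfl
    have key : ∀ b, Entry s (𝔐.numeral k) (𝔐.bit b) ↔ Entry r (𝔐.numeral k) (𝔐.bit b) := by
      intro b
      rw [entry_bit_iff hs, entry_bit_iff hrs, hsr, Function.update_of_ne hk]
    intro z
    constructor
    · intro hz
      rcases hs.2 _ z hz with rfl | rfl
      exacts [(key false).1 hz, (key true).1 hz]
    · intro hz
      rcases hrs.2 _ z hz with rfl | rfl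
      exacts [(key false).2 hz, (key true).2 hz]

theorem CodesRel.relIsLiteral_iff (h : CodesRel c R) :
    RelIsLiteral (𝔐.bit b) c ↔ R = BoolRel.literal b := by
  have key : ∀ s : 𝔐.Num, IsString s (𝔐.numeral 1) →
      ((toVec s : Fin 1 → Bool) = (fun _ => b) ↔ Entry s 0 (𝔐.bit b)) := by
    intro s hs
    have := entry_bit_iff hs 0 b
    rw [funext_iff, Fin.forall_fin_one, ← this]
    exact Iff.rfl
  constructor
  · rintro ⟨h1, hm⟩
    obtain ⟨n, rel⟩ := R
    obtain rfl : n = 1 := by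
      rw [← numeral_inj (𝔐 := 𝔐), numeral_one]
      exact h.1.arity_unique h1
    rw [BoolRel.literal, BoolRel.mk.injEq, heq_eq_eq]
    refine ⟨rfl, Set.ext fun r => ?_⟩
    obtain ⟨s, hs, rfl⟩ := exists_toVec (𝔐 := 𝔐) r
    rw [Set.mem_singleton_iff, key s hs, ← h.relMem_iff hs, hm, ← numeral_one]
    exact and_iff_right hs
  · rintro rfl
    refine ⟨numeral_one (𝔐 := 𝔐) ▸ h.1, fun s => ?_⟩
    rw [← numeral_one]
    constructor
    · intro hs
      have hs' := h.1.isString hs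
      exact ⟨hs', (key s hs').1 ((h.relMem_iff hs').1 hs)⟩
    · rintro ⟨hs, hb⟩
      exact (h.relMem_iff hs).2 ((key s hs).2 hb)

/-- Binary strings of standard length inject into standard vectors, so the vectors of `R` form a
metatheoretically finite subset of the model and hence have a code. -/
theorem exists_codesRel (hR : R.rel.Nonempty) : ∃ c : 𝔐.Num, CodesRel c R := by
  let X : Set 𝔐.Num := {s | IsString s (𝔐.numeral R.arity) ∧ toVec s ∈ R.rel}
  have hX : X.Finite := Set.Finite.of_injOn (f := fun s => (toVec s : Fin R.arity → Bool))
    (t := Set.univ) (fun _ _ => trivial) (fun s hs t ht h => toVec_injective hs.1 ht.1 h)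
    Set.finite_univ
  have hXr := RecP.of_finite hX
  have hmem : ∀ s, FMem s (mkSet (codeBound (pair (𝔐.numeral R.arity) 1)) fun s => s ∈ X) ↔
      s ∈ X := by
    intro s
    rw [fmem_mkSet]
    exact and_iff_right_of_imp fun h => h.1.lt_codeBound
  have hrel : ∀ s, RelMem s (pair (𝔐.numeral R.arity)
      (mkSet (codeBound (pair (𝔐.numeral R.arity) 1)) fun s => s ∈ X)) ↔ s ∈ X := by
    intro s
    rw [← hmem]
    constructor
    · rintro ⟨n, a, e, h⟩
      obtain ⟨rfl, rfl⟩ := pair_inj.1 e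
      exact h
    · exact fun h => ⟨_, _, rfl, h⟩
  refine ⟨_, ⟨_, rfl, isFinset_mkSet _ _, ?_, fun s hs => ((hmem s).1 hs).1⟩, fun r => ?_⟩
  · obtain ⟨r, hr⟩ := hR
    obtain ⟨s, hs, rfl⟩ := exists_toVec (𝔐 := 𝔐) r
    exact ⟨s, (hmem s).2 ⟨hs, hr⟩⟩
  · simp only [hrel]
    constructor
    · intro hr
      obtain ⟨s, hs, rfl⟩ := exists_toVec (𝔐 := 𝔐) r
      exact ⟨s, ⟨hs, hr⟩, fun i => (entry_bit_iff hs i _).2 rfl⟩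
    · rintro ⟨s, ⟨hs, hsR⟩, h⟩
      have : toVec s = r := funext fun i => (entry_bit_iff hs i _).1 (h i)
      rwa [← this]

end CodesRel

/-- Each condition transfers along codes. Nonemptiness ensures that every member of `S` has a code,
so none is invisible to the model. -/
theorem easyClass_iff_easySet {S : Set BoolRel} (hS : ∀ R ∈ S, R.rel.Nonempty) :
    EasyClass {c : 𝔐.Num | ∃ R ∈ S, CodesRel c R} ↔ BoolRel.EasySet S := by
  have key : ∀ {p : 𝔐.Num → Prop} {q : BoolRel → Prop}, (∀ c R, CodesRel c R → (p c ↔ q R)) →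
      ((∀ c ∈ {c : 𝔐.Num | ∃ R ∈ S, CodesRel c R}, p c) ↔ ∀ R ∈ S, q R) := by
    intro p q hpq
    constructor
    · intro h R hR
      obtain ⟨c, hc⟩ := exists_codesRel (𝔐 := 𝔐) (hS R hR)
      exact (hpq c R hc).1 (h c ⟨R, hR, hc⟩)
    · rintro h c ⟨R, hR, hc⟩
      exact (hpq c R hc).2 (h R hR)
  unfold EasyClass BoolRel.EasySet
  refine or_congr (key fun c R h => ?_) (or_congr (key fun c R h => ?_)
    (or_congr (key fun c R h => ?_) (key fun c R h => ?_)))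
  · exact h.relValid_iff (b := false)
  · exact h.relValid_iff (b := true)
  · rw [← h.relDefault_iff, ← h.relIsLiteral_iff]; exact Iff.rfl
  · rw [← h.relDefault_iff, ← h.relIsLiteral_iff]; exact Iff.rfl

/-! ### The dichotomy in both senses -/

theorem satClass_iff_wkl {S : Set 𝔐.Num} (hS : ∀ c ∈ S, ∃ n, IsRel c n) (h : ¬ EasyClass S) :
    SATClass S ↔ 𝔐.WKL :=
  ⟨fun hSAT => wkl_of_separation (separation_of_not_easy hS h hSAT), fun hW => satClass_of_wkl hW S⟩

end L2Structure

theorem theorem1p7 :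
    (∀ S : Set BoolRel, (∀ R ∈ S, R.rel.Nonempty) →
      (BoolRel.EasySet S → RCA0Proves.{u} (SAT S)) ∧
      (¬ BoolRel.EasySet S → RCA0Proves.{u} (fun 𝔐 => SAT S 𝔐 ↔ 𝔐.WKL))) ∧
    RCA0Proves.{u} (fun 𝔐 => ∀ S : Set 𝔐.Num, (∀ c ∈ S, ∃ n, L2Structure.IsRel c n) →
      (L2Structure.EasyClass S → L2Structure.SATClass S) ∧
      (¬ L2Structure.EasyClass S → (L2Structure.SATClass S ↔ 𝔐.WKL))) := by
  refine ⟨fun S hS => ⟨fun h 𝔐 hM => ?_, fun h 𝔐 hM => ?_⟩, fun 𝔐 hM S hS => ?_⟩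
  · have : L2Structure.RCA 𝔐 := ⟨hM⟩
    exact L2Structure.satClass_of_easy ((L2Structure.easyClass_iff_easySet hS).2 h)
  · have : L2Structure.RCA 𝔐 := ⟨hM⟩
    exact L2Structure.satClass_iff_wkl (fun c ⟨R, _, hc⟩ => ⟨_, hc.1⟩)
      (mt (L2Structure.easyClass_iff_easySet hS).1 h)
  · have : L2Structure.RCA 𝔐 := ⟨hM⟩
    exact ⟨L2Structure.satClass_of_easy, L2Structure.satClass_iff_wkl hS⟩
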